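/- Let $n\ge 2$, and let $f$ be a holomorphic function near the point $p=(t_0,0)$ of $\mathbb{C}\times\mathbb{C}^n$, with coordinates $(t,x_1,\dots,x_n)$. Assume that near $p$ the singular locus $\{f=0,\ df=0\}$ and the critical locus $\{\partial f/\partial x_1=\dots=\partial f/\partial x_n=0\}$ of the map $(f,t)$ are both equal to $\{x_1=\dots=x_n=0\}$. (This is the situation near a point of $S^*=S\setminus\{0\}$, where $S$ is the one-dimensional singular locus of a germ $f$ on $\mathbb{C}^{n+1}$ and $t$ is an auxiliary non-singular function whose restriction to the critical curve of $(f,t)$ is finite and unramified outside $0$; coordinates are chosen such that $S^*=\{x=0\}$.) All sheaves below are considered through their stalks at $p$. Let $\mathcal{O}$ be the sheaf of holomorphic functions, $\mathfrak{M}=(x_1,\dots,x_n)$, and let $J_/(f)=(\partial f/\partial x_1,\dots,\partial f/\partial x_n)$ be the relative Jacobian ideal. Let $\hat\Omega^\bullet_/$ be the $t$-relative holomorphic differential forms, formally completed in $f$, with the relative differential $d_/$, and let $$\mathbb{E}=\hat\Omega^n_/\big/ d_/\big(\ker(d_/f\wedge\cdot:\hat\Omega^{n-1}_/\to\hat\Omega^{n}_/)\big)$$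 be the cohomology in degree $n$ of the complex $(\ker(d_/f\wedge\cdot)^\bullet,d_/)$. It carries the operations $a$ (multiplication by $f$), $b[d_/\xi]=[d_/f\wedge\xi]$, $\nabla[d_/\xi]=[d_/f\wedge\frac{\partial\xi}{\partial t}-\frac{\partial f}{\partial t}\,d_/\xi]$, and the action of $\mathcal{O}_D[[b]]$, where $\mathcal{O}_D$ is the sheaf of holomorphic functions of $t$. Let $\mathbb{G}$ be the largest sub-$\mathcal{O}_D[[b]]$-module $N$ of $\mathbb{E}$ that is stable by $a$ and by $b^{-1}\nabla$, the latter meaning $\nabla N\subset bN$. For an integer $k\ge 0$ let $\mathcal{M}^k$ be the image of $\mathfrak{M}^k\hat\Omega^n_/$ in $\mathbb{E}$. If $k\ge 0$ is an integer such that $$\mathfrak{M}^k\cdot\frac{\partial f}{\partial t}\subset\mathfrak{M}^{k+1}\cdot J_/(f),$$ then $\mathcal{M}^k\subset\mathbb{G}$. -/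

import Mathlib

open Filter Topology

noncomputable section

namespace RelBrieskorn

/-! ## Germs of holomorphic functions

The ambient space is `ℂ × ℂⁿ` with coordinates `(t, x₁, …, xₙ)`; everything is taken at the
point `(t₀, 0)`. -/

/-- Functions on `ℂ × ℂⁿ` that are holomorphic near `(t₀, 0)`. -/
def HolFun (n : ℕ) (t₀ : ℂ) : Subring (ℂ × (Fin n → ℂ) → ℂ) where
  carrier := {g | AnalyticAt ℂ g (t₀, 0)}
  mul_mem' ha hb := AnalyticAt.mul ha hb
  one_mem' := analyticAt_const
  add_mem' ha hb := AnalyticAt.add ha hb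
  zero_mem' := analyticAt_const
  neg_mem' ha := AnalyticAt.neg ha

variable {n : ℕ} {t₀ : ℂ}

/-- The functions that vanish in a neighbourhood of `(t₀, 0)`. -/
def nullIdeal (n : ℕ) (t₀ : ℂ) : Ideal (HolFun n t₀) where
  carrier := {g | ∀ᶠ y in 𝓝 ((t₀, 0) : ℂ × (Fin n → ℂ)), g.1 y = 0}
  add_mem' {a b} ha hb := by
    filter_upwards [ha, hb] with y h1 h2
    change a.1 y + b.1 y = 0
    rw [h1, h2, add_zero]
  zero_mem' := Eventually.of_forall fun _ => rfl
  smul_mem' c a ha := by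
    filter_upwards [ha] with y h1
    change c.1 y * a.1 y = 0
    rw [h1, mul_zero]

/-- The local ring `𝒪` of germs at `(t₀, 0)` of holomorphic functions. -/
def HolGerm (n : ℕ) (t₀ : ℂ) : Type := HolFun n t₀ ⧸ nullIdeal n t₀

instance : CommRing (HolGerm n t₀) := inferInstanceAs (CommRing (HolFun n t₀ ⧸ nullIdeal n t₀))

/-- The germ of a holomorphic function. -/
def germ : HolFun n t₀ →+* HolGerm n t₀ := Ideal.Quotient.mk (nullIdeal n t₀)

lemma germ_eq_iff {g h : HolFun n t₀} :
    germ g = germ h ↔ g.1 =ᶠ[𝓝 (t₀, 0)] h.1 := by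
  change Ideal.Quotient.mk (nullIdeal n t₀) g = Ideal.Quotient.mk (nullIdeal n t₀) h ↔ _
  rw [Ideal.Quotient.eq]
  constructor
  · intro H
    filter_upwards [H] with y hy
    exact sub_eq_zero.1 hy
  · intro H
    change ∀ᶠ y in 𝓝 ((t₀, 0) : ℂ × (Fin n → ℂ)), (g - h).1 y = 0
    filter_upwards [H] with y hy
    exact sub_eq_zero.2 hy

/-- The derivative of a holomorphic function in the constant direction `v`. -/
def dirFun (v : ℂ × (Fin n → ℂ)) (g : HolFun n t₀) : HolFun n t₀ :=
  ⟨fun y => fderiv ℂ g.1 y v, by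
    have h : AnalyticAt ℂ (fderiv ℂ g.1) (t₀, 0) := AnalyticAt.fderiv g.2
    exact ((ContinuousLinearMap.apply ℂ ℂ v).analyticAt _).comp h⟩

lemma germ_dirFun_congr (v : ℂ × (Fin n → ℂ)) {g h : HolFun n t₀} (H : germ g = germ h) :
    germ (dirFun v g) = germ (dirFun v h) := by
  rw [germ_eq_iff] at H ⊢
  filter_upwards [H.fderiv (𝕜 := ℂ)] with y hy
  change fderiv ℂ g.1 y v = fderiv ℂ h.1 y v
  rw [hy]

lemma germ_dirFun_add (v : ℂ × (Fin n → ℂ)) (g h : HolFun n t₀) :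
    germ (dirFun v (g + h)) = germ (dirFun v g) + germ (dirFun v h) := by
  rw [← map_add, germ_eq_iff]
  have hg : AnalyticAt ℂ g.1 (t₀, 0) := g.2
  have hh : AnalyticAt ℂ h.1 (t₀, 0) := h.2
  filter_upwards [hg.eventually_analyticAt, hh.eventually_analyticAt] with y h1 h2
  change fderiv ℂ (g.1 + h.1) y v = fderiv ℂ g.1 y v + fderiv ℂ h.1 y v
  rw [fderiv_add h1.differentiableAt h2.differentiableAt]
  rfl

lemma germ_dirFun_mul (v : ℂ × (Fin n → ℂ)) (g h : HolFun n t₀) :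
    germ (dirFun v (g * h)) = germ g * germ (dirFun v h) + germ (dirFun v g) * germ h := by
  rw [← map_mul, ← map_mul, ← map_add, germ_eq_iff]
  have hg : AnalyticAt ℂ g.1 (t₀, 0) := g.2
  have hh : AnalyticAt ℂ h.1 (t₀, 0) := h.2
  filter_upwards [hg.eventually_analyticAt, hh.eventually_analyticAt] with y h1 h2
  change fderiv ℂ (g.1 * h.1) y v = g.1 y * fderiv ℂ h.1 y v + fderiv ℂ g.1 y v * h.1 y
  rw [fderiv_mul h1.differentiableAt h2.differentiableAt]
  simp [mul_comm]

/-- The derivative of germs in the constant direction `v`. -/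
def dirGerm (v : ℂ × (Fin n → ℂ)) : HolGerm n t₀ →+ HolGerm n t₀ :=
  AddMonoidHom.mk'
    (Quotient.lift (fun g => germ (dirFun v g)) fun g h H =>
      germ_dirFun_congr v (Quotient.sound H))
    (by
      rintro ⟨g⟩ ⟨h⟩
      exact germ_dirFun_add v g h)

lemma dirGerm_germ (v : ℂ × (Fin n → ℂ)) (g : HolFun n t₀) :
    dirGerm v (germ g) = germ (dirFun v g) := rfl

lemma germ_surjective : Function.Surjective (germ : HolFun n t₀ → HolGerm n t₀) :=
  Ideal.Quotient.mk_surjective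

lemma dirGerm_mul (v : ℂ × (Fin n → ℂ)) (p q : HolGerm n t₀) :
    dirGerm v (p * q) = p * dirGerm v q + dirGerm v p * q := by
  obtain ⟨g, rfl⟩ := germ_surjective p
  obtain ⟨h, rfl⟩ := germ_surjective q
  exact germ_dirFun_mul v g h

/-- The direction of the coordinate `t`. -/
def eT (n : ℕ) : ℂ × (Fin n → ℂ) := (1, 0)

/-- The direction of the coordinate `xᵢ`. -/
def eX (i : Fin n) : ℂ × (Fin n → ℂ) := (0, Pi.single i 1)

/-- The coordinate function `xᵢ`. -/
def coordX (t₀ : ℂ) (i : Fin n) : HolFun n t₀ :=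
  ⟨fun y => y.2 i,
    (((ContinuousLinearMap.proj i : (Fin n → ℂ) →L[ℂ] ℂ).comp
      (ContinuousLinearMap.snd ℂ ℂ (Fin n → ℂ))).analyticAt (t₀, 0) :)⟩

/-- The ideal `𝔐 = (x₁, …, xₙ)` of `𝒪`, the reduced ideal of `{x = 0}`. -/
def idealM (n : ℕ) (t₀ : ℂ) : Ideal (HolGerm n t₀) :=
  Ideal.span (Set.range fun i => germ (coordX t₀ i))

/-- The relative jacobian ideal `J_/(f) = (∂f/∂x₁, …, ∂f/∂xₙ)` of `𝒪`. -/
def relJac (f : HolFun n t₀) : Ideal (HolGerm n t₀) :=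
  Ideal.span (Set.range fun i => dirGerm (eX i) (germ f))

/-! ## The formal completion in `f` -/

/-- Germs at `(t₀, 0)` of sections of the sheaf `𝒪⟦z⟧`: formal power series in `z` whose
coefficients are holomorphic in one common neighbourhood of `(t₀, 0)`. -/
def UnifSeries (n : ℕ) (t₀ : ℂ) : Subring (PowerSeries (HolGerm n t₀)) where
  carrier := {F | ∃ U ∈ 𝓝 ((t₀, 0) : ℂ × (Fin n → ℂ)), ∀ k, ∃ g : HolFun n t₀,
    AnalyticOnNhd ℂ g.1 U ∧ germ g = PowerSeries.coeff k F}
  mul_mem' := by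
    rintro F G ⟨U, hU, hF⟩ ⟨V, hV, hG⟩
    choose u hu hu' using hF
    choose w hw hw' using hG
    refine ⟨U ∩ V, inter_mem hU hV, fun k =>
      ⟨∑ p ∈ Finset.HasAntidiagonal.antidiagonal k, u p.1 * w p.2, ?_, ?_⟩⟩
    · have : (∑ p ∈ Finset.HasAntidiagonal.antidiagonal k, u p.1 * w p.2 : HolFun n t₀).1
          = ∑ p ∈ Finset.HasAntidiagonal.antidiagonal k, (u p.1).1 * (w p.2).1 := by
        simp
      rw [this]
      exact Finset.analyticOnNhd_sum _ fun p _ =>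
        ((hu p.1).mono Set.inter_subset_left).mul ((hw p.2).mono Set.inter_subset_right)
    · rw [PowerSeries.coeff_mul, map_sum]
      exact Finset.sum_congr rfl fun p _ => by rw [map_mul, hu', hw']
  one_mem' := by
    refine ⟨Set.univ, univ_mem, fun k => ⟨if k = 0 then 1 else 0, ?_, ?_⟩⟩
    · split_ifs
      · exact analyticOnNhd_const
      · exact analyticOnNhd_const
    · rw [PowerSeries.coeff_one]
      split_ifs <;> simp
  add_mem' := by
    rintro F G ⟨U, hU, hF⟩ ⟨V, hV, hG⟩
    refine ⟨U ∩ V, inter_mem hU hV, fun k => ?_⟩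
    obtain ⟨u, hu, hu'⟩ := hF k
    obtain ⟨w, hw, hw'⟩ := hG k
    exact ⟨u + w, (hu.mono Set.inter_subset_left).add (hw.mono Set.inter_subset_right),
      by rw [map_add, map_add, hu', hw']⟩
  zero_mem' := ⟨Set.univ, univ_mem, fun k => ⟨0, analyticOnNhd_const, by simp⟩⟩
  neg_mem' := by
    rintro F ⟨U, hU, hF⟩
    refine ⟨U, hU, fun k => ?_⟩
    obtain ⟨u, hu, hu'⟩ := hF k
    exact ⟨-u, hu.neg, by rw [map_neg, map_neg, hu']⟩

lemma exists_analyticOnNhd (g : HolFun n t₀) :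
    ∃ U ∈ 𝓝 ((t₀, 0) : ℂ × (Fin n → ℂ)), AnalyticOnNhd ℂ g.1 U :=
  ⟨{y | AnalyticAt ℂ g.1 y}, AnalyticAt.eventually_analyticAt g.2, fun _ h => h⟩

/-- A germ, seen as a constant series. -/
def constSeries : HolGerm n t₀ →+* UnifSeries n t₀ :=
  (PowerSeries.C).codRestrict (UnifSeries n t₀) (by
    intro p
    obtain ⟨g, rfl⟩ := germ_surjective p
    obtain ⟨U, hU, h⟩ := exists_analyticOnNhd g
    refine ⟨U, hU, fun k => ⟨if k = 0 then g else 0, ?_, ?_⟩⟩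
    · split_ifs
      · exact h
      · exact analyticOnNhd_const
    · rw [PowerSeries.coeff_C]
      split_ifs <;> simp)

/-- The variable `z`. -/
def zSeries (n : ℕ) (t₀ : ℂ) : UnifSeries n t₀ :=
  ⟨PowerSeries.X, Set.univ, univ_mem, fun k => ⟨if k = 1 then 1 else 0, by
      split_ifs
      · exact analyticOnNhd_const
      · exact analyticOnNhd_const, by
      rw [PowerSeries.coeff_X]
      split_ifs <;> simp⟩⟩

/-- The ideal generated by `z - f`. -/
def zIdeal (f : HolFun n t₀) : Ideal (UnifSeries n t₀) :=
  Ideal.span {zSeries n t₀ - constSeries (germ f)}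

/-- The stalk at `(t₀, 0)` of the formal completion in `f` of the sheaf of holomorphic functions:
formal series `∑ gₖ fᵏ` with all `gₖ` holomorphic in one neighbourhood of `(t₀, 0)`.
(For a ring `A` and a non-zero-divisor `f` one has `lim A / fᵏ A = A⟦z⟧ / (z - f)`; this is
applied to the rings `A = 𝒪(U)`, and `U` runs through the small balls around `(t₀, 0)`.) -/
def Hat (f : HolFun n t₀) : Type := UnifSeries n t₀ ⧸ zIdeal f

instance (f : HolFun n t₀) : CommRing (Hat f) :=
  inferInstanceAs (CommRing (UnifSeries n t₀ ⧸ zIdeal f))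

/-- The class in the formal completion of a series. -/
def mkHat (f : HolFun n t₀) : UnifSeries n t₀ →+* Hat f := Ideal.Quotient.mk (zIdeal f)

/-- The natural map from germs of holomorphic functions to the formal completion. -/
def toHat (f : HolFun n t₀) : HolGerm n t₀ →+* Hat f :=
  (mkHat f).comp constSeries

/-- The derivation `∂ᵥ + (∂ᵥ f) ∂/∂z` of formal series; it extends `∂ᵥ` and kills `z - f`. -/
def dirPow (f : HolFun n t₀) (v : ℂ × (Fin n → ℂ)) (F : PowerSeries (HolGerm n t₀)) :
    PowerSeries (HolGerm n t₀) :=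
  PowerSeries.mk fun k => dirGerm v (PowerSeries.coeff k F) +
    ((k : HolGerm n t₀) + 1) * dirGerm v (germ f) * PowerSeries.coeff (k + 1) F

lemma dirPow_eq (f : HolFun n t₀) (v : ℂ × (Fin n → ℂ)) (F : PowerSeries (HolGerm n t₀)) :
    dirPow f v F = (PowerSeries.mk fun k => dirGerm v (PowerSeries.coeff k F)) +
      PowerSeries.C (dirGerm v (germ f)) * PowerSeries.derivative _ F := by
  ext k
  simp only [dirPow, PowerSeries.coeff_mk, map_add, PowerSeries.coeff_C_mul,
    PowerSeries.coeff_derivative]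
  ring

lemma dirPow_mul (f : HolFun n t₀) (v : ℂ × (Fin n → ℂ)) (F G : PowerSeries (HolGerm n t₀)) :
    dirPow f v (F * G) = F * dirPow f v G + dirPow f v F * G := by
  have h : (PowerSeries.mk fun k => dirGerm v (PowerSeries.coeff k (F * G)))
      = F * (PowerSeries.mk fun k => dirGerm v (PowerSeries.coeff k G))
        + (PowerSeries.mk fun k => dirGerm v (PowerSeries.coeff k F)) * G := by
    ext k
    simp only [PowerSeries.coeff_mk, map_add, PowerSeries.coeff_mul, map_sum, dirGerm_mul,
      Finset.sum_add_distrib]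
  simp only [dirPow_eq]
  rw [h, Derivation.leibniz]
  simp only [smul_eq_mul]
  ring

lemma dirPow_mem (f : HolFun n t₀) (v : ℂ × (Fin n → ℂ)) {F : PowerSeries (HolGerm n t₀)}
    (hF : F ∈ UnifSeries n t₀) : dirPow f v F ∈ UnifSeries n t₀ := by
  obtain ⟨U, hU, h⟩ := hF
  choose u hu hu' using h
  obtain ⟨V, hV, hf⟩ := exists_analyticOnNhd (dirFun v f)
  refine ⟨U ∩ V, inter_mem hU hV, fun k =>
    ⟨dirFun v (u k) + ((k : HolFun n t₀) + 1) * dirFun v f * u (k + 1), ?_, ?_⟩⟩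
  · have h1 : AnalyticOnNhd ℂ (dirFun v (u k)).1 (U ∩ V) := fun y hy =>
      ((ContinuousLinearMap.apply ℂ ℂ v).analyticAt _).comp (hu k y hy.1).fderiv
    have h2 : AnalyticOnNhd ℂ (((k : HolFun n t₀) + 1 : HolFun n t₀)).1 (U ∩ V) := by
      have : (((k : HolFun n t₀) + 1 : HolFun n t₀)).1 = fun _ => (k : ℂ) + 1 := by
        ext y
        simp
      rw [this]
      exact analyticOnNhd_const
    exact h1.add ((h2.mul (hf.mono Set.inter_subset_right)).mul
      ((hu (k + 1)).mono Set.inter_subset_left))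
  · simp only [dirPow, PowerSeries.coeff_mk, map_add, map_mul, map_natCast, map_one, hu',
      ← dirGerm_germ]

/-- `dirPow` on series with a common domain. -/
def dirSeries (f : HolFun n t₀) (v : ℂ × (Fin n → ℂ)) : UnifSeries n t₀ →+ UnifSeries n t₀ :=
  AddMonoidHom.mk' (fun F => ⟨dirPow f v F.1, dirPow_mem f v F.2⟩) (by
    intro F G
    apply Subtype.ext
    change dirPow f v (F.1 + G.1) = dirPow f v F.1 + dirPow f v G.1
    ext k
    simp only [dirPow, PowerSeries.coeff_mk, map_add]
    ring)

lemma dirSeries_mul (f : HolFun n t₀) (v : ℂ × (Fin n → ℂ)) (F G : UnifSeries n t₀) :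
    dirSeries f v (F * G) = F * dirSeries f v G + dirSeries f v F * G :=
  Subtype.ext (dirPow_mul f v F.1 G.1)

lemma dirGerm_one (v : ℂ × (Fin n → ℂ)) : dirGerm v (1 : HolGerm n t₀) = 0 := by
  have h := dirGerm_mul v (1 : HolGerm n t₀) 1
  simpa using h

lemma dirSeries_const (f : HolFun n t₀) (v : ℂ × (Fin n → ℂ)) (p : HolGerm n t₀) :
    dirSeries f v (constSeries p) = constSeries (dirGerm v p) := by
  apply Subtype.ext
  change dirPow f v (PowerSeries.C p) = PowerSeries.C (dirGerm v p)
  ext k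
  simp only [dirPow, PowerSeries.coeff_mk, PowerSeries.coeff_C]
  split_ifs <;> simp_all

lemma dirSeries_gen (f : HolFun n t₀) (v : ℂ × (Fin n → ℂ)) :
    dirSeries f v (zSeries n t₀ - constSeries (germ f)) = 0 := by
  rw [map_sub, dirSeries_const, sub_eq_zero]
  apply Subtype.ext
  change dirPow f v PowerSeries.X = PowerSeries.C (dirGerm v (germ f))
  ext k
  simp only [dirPow, PowerSeries.coeff_mk, PowerSeries.coeff_C, PowerSeries.coeff_X]
  rcases k with _ | k
  · simp
  · by_cases h : k = 0 <;> simp [h, dirGerm_one]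

lemma dirSeries_zIdeal (f : HolFun n t₀) (v : ℂ × (Fin n → ℂ)) :
    (zIdeal f).toAddSubgroup ≤ (zIdeal f).toAddSubgroup.comap (dirSeries f v) := by
  intro F hF
  obtain ⟨Q, rfl⟩ := Ideal.mem_span_singleton'.1 (show F ∈ zIdeal f from hF)
  change dirSeries f v (Q * _) ∈ zIdeal f
  rw [dirSeries_mul, dirSeries_gen, mul_zero, zero_add]
  exact Ideal.mul_mem_left _ _ (Ideal.subset_span rfl)

/-- The derivative in the constant direction `v` on the formal completion. -/
def dirHat (f : HolFun n t₀) (v : ℂ × (Fin n → ℂ)) : Hat f →+ Hat f :=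
  QuotientAddGroup.map (zIdeal f).toAddSubgroup (zIdeal f).toAddSubgroup (dirSeries f v)
    (dirSeries_zIdeal f v)

lemma dirHat_mk (f : HolFun n t₀) (v : ℂ × (Fin n → ℂ)) (F : UnifSeries n t₀) :
    dirHat f v (mkHat f F) = mkHat f (dirSeries f v F) := rfl

lemma dirHat_mul (f : HolFun n t₀) (v : ℂ × (Fin n → ℂ)) (p q : Hat f) :
    dirHat f v (p * q) = p * dirHat f v q + dirHat f v p * q := by
  obtain ⟨F, rfl⟩ : ∃ F, mkHat f F = p := Ideal.Quotient.mk_surjective p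
  obtain ⟨G, rfl⟩ : ∃ G, mkHat f G = q := Ideal.Quotient.mk_surjective q
  rw [← map_mul, dirHat_mk, dirHat_mk, dirHat_mk, dirSeries_mul, map_add, map_mul, map_mul]

lemma dirHat_toHat (f : HolFun n t₀) (v : ℂ × (Fin n → ℂ)) (p : HolGerm n t₀) :
    dirHat f v (toHat f p) = toHat f (dirGerm v p) := by
  change mkHat f (dirSeries f v (constSeries p)) = _
  rw [dirSeries_const]
  rfl

/-! ## Relative differential forms, formally completed in `f` -/

/-- Completed `t`-relative forms `∑ ω_I dx_I` of degree `p`: the sum runs over the `p`-element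
sets `I` of indices, and `dx_I` is the product of the `dxᵢ`, `i ∈ I`, in increasing order. -/
abbrev Form (f : HolFun n t₀) (p : ℕ) : Type := {I : Finset (Fin n) // I.card = p} → Hat f

/-- The product `dxᵢ ∧ ω`. -/
def dxWedge (f : HolFun n t₀) (p : ℕ) (i : Fin n) : Form f p →ₗ[Hat f] Form f (p + 1) where
  toFun ω I :=
    if h : i ∈ I.1 then
      (-1) ^ (I.1.filter (· < i)).card *
        ω ⟨I.1.erase i, by rw [Finset.card_erase_of_mem h, I.2, Nat.add_sub_cancel]⟩
    else 0
  map_add' ω η := by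
    ext I
    by_cases h : i ∈ I.1 <;> simp [h, mul_add]
  map_smul' r ω := by
    ext I
    by_cases h : i ∈ I.1 <;> simp [h, mul_left_comm]

/-- The derivative of the coefficients of a form in the constant direction `v`. -/
def dirForm (f : HolFun n t₀) (p : ℕ) (v : ℂ × (Fin n → ℂ)) : Form f p →+ Form f p where
  toFun ω I := dirHat f v (ω I)
  map_zero' := by ext I; simp
  map_add' ω η := by ext I; simp

/-- The relative differential `d_/ ω = ∑ᵢ dxᵢ ∧ ∂ω/∂xᵢ`. -/
def dRel (f : HolFun n t₀) (p : ℕ) : Form f p →+ Form f (p + 1) :=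
  ∑ i, (dxWedge f p i).toAddMonoidHom.comp (dirForm f p (eX i))

/-- The product `d_/f ∧ ω`, where `d_/f = ∑ᵢ (∂f/∂xᵢ) dxᵢ`. -/
def dfWedge (f : HolFun n t₀) (p : ℕ) : Form f p →ₗ[Hat f] Form f (p + 1) :=
  ∑ i, toHat f (dirGerm (eX i) (germ f)) • dxWedge f p i

lemma dRel_smul (f : HolFun n t₀) (p : ℕ) (r : Hat f) (ω : Form f p) :
    dRel f p (r • ω) = r • dRel f p ω + ∑ i, dirHat f (eX i) r • dxWedge f p i ω := by
  simp only [dRel, AddMonoidHom.finsetSum_apply, AddMonoidHom.comp_apply,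
    LinearMap.toAddMonoidHom_coe, Finset.smul_sum, ← Finset.sum_add_distrib]
  refine Finset.sum_congr rfl fun i _ => ?_
  have h : dirForm f p (eX i) (r • ω)
      = r • dirForm f p (eX i) ω + dirHat f (eX i) r • ω := by
    ext I
    exact dirHat_mul f (eX i) r (ω I)
  rw [h, map_add, map_smul, map_smul]

/-! ## The module `𝔼` and its operations

From here on `n = m + 1`. -/

variable {m : ℕ}

/-- The image under `d_/` of the kernel of `d_/f ∧ ·` in degree `n - 1`. -/
def boundaries (f : HolFun (m + 1) t₀) : AddSubgroup (Form f (m + 1)) :=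
  (dfWedge f m).toAddMonoidHom.ker.map (dRel f m)

/-- The stalk of `𝔼`, the cohomology in degree `n` of the complex `(Ker d_/f ∧ ·, d_/)` of
completed relative forms. There are no relative forms of degree `n + 1`, so all forms of degree
`n` are closed and in the kernel of `d_/f ∧ ·`. -/
abbrev EE (f : HolFun (m + 1) t₀) : Type := Form f (m + 1) ⧸ boundaries f

/-- The class in `𝔼` of a form of degree `n`. -/
def cls (f : HolFun (m + 1) t₀) : Form f (m + 1) →+ EE f := QuotientAddGroup.mk' (boundaries f)

/-- Multiplication by `r` preserves the boundaries if `d_/r` is a multiple of `d_/f`. -/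
lemma smul_boundaries (f : HolFun (m + 1) t₀) (r c : Hat f)
    (hr : ∀ i, dirHat f (eX i) r = c * toHat f (dirGerm (eX i) (germ f))) :
    boundaries f ≤ (boundaries f).comap (DistribSMul.toAddMonoidHom (Form f (m + 1)) r) := by
  rintro _ ⟨κ, hκ, rfl⟩
  have hκ' : dfWedge f m κ = 0 := hκ
  refine ⟨r • κ, ?_, ?_⟩
  · change dfWedge f m (r • κ) = 0
    rw [map_smul, hκ', smul_zero]
  · change dRel f m (r • κ) = r • dRel f m κ
    have h : ∑ i, dirHat f (eX i) r • dxWedge f m i κ = c • dfWedge f m κ := by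
      simp only [dfWedge, LinearMap.sum_apply, LinearMap.smul_apply, Finset.smul_sum, hr,
        mul_smul]
    rw [dRel_smul, h, hκ', smul_zero, add_zero]

/-- The operation `a` on `𝔼`: multiplication by `f`. -/
def opA (f : HolFun (m + 1) t₀) : EE f →+ EE f :=
  QuotientAddGroup.map (boundaries f) (boundaries f)
    (DistribSMul.toAddMonoidHom (Form f (m + 1)) (toHat f (germ f)))
    (smul_boundaries f _ 1 fun i => by rw [dirHat_toHat, one_mul])

/-- Functions of one variable that are holomorphic near `t₀`. -/
def HolD (t₀ : ℂ) : Set (ℂ → ℂ) := {φ | AnalyticAt ℂ φ t₀}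

/-- The function `φ(t)` on `ℂ × ℂⁿ`. -/
def pullT (n : ℕ) (φ : HolD t₀) : HolFun n t₀ :=
  ⟨fun y => φ.1 y.1,
    AnalyticAt.fun_comp (f := fun y : ℂ × (Fin n → ℂ) => y.1) (x := (t₀, 0)) φ.2 analyticAt_fst⟩

lemma dirGerm_pullT (φ : HolD t₀) (i : Fin n) : dirGerm (eX i) (germ (pullT n φ)) = 0 := by
  rw [dirGerm_germ, ← map_zero germ, germ_eq_iff]
  have hφ : AnalyticAt ℂ φ.1 t₀ := φ.2
  have hφ' := (continuous_fst.tendsto ((t₀, 0) : ℂ × (Fin n → ℂ))).eventually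
    hφ.eventually_analyticAt
  filter_upwards [hφ'] with y hy
  change fderiv ℂ (fun y : ℂ × (Fin n → ℂ) => φ.1 y.1) y (eX i) = 0
  have h := (hy.differentiableAt.hasFDerivAt).comp y
    (hasFDerivAt_fst (𝕜 := ℂ) (E := ℂ) (F := Fin n → ℂ) (p := y))
  rw [show (fun y : ℂ × (Fin n → ℂ) => φ.1 y.1) = φ.1 ∘ Prod.fst from rfl, h.fderiv]
  simp [eX]

/-- The action on `𝔼` of a germ `φ ∈ 𝒪_D`: multiplication by `φ(t)`. -/
def opT (f : HolFun (m + 1) t₀) (φ : HolD t₀) : EE f →+ EE f :=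
  QuotientAddGroup.map (boundaries f) (boundaries f)
    (DistribSMul.toAddMonoidHom (Form f (m + 1)) (toHat f (germ (pullT (m + 1) φ))))
    (smul_boundaries f _ 0 fun i => by rw [dirHat_toHat, dirGerm_pullT, map_zero, zero_mul])

/-- `RelB f x y` says `y = b x`. The operation `b` is `(d_/f ∧ ·) ∘ d_/⁻¹`, that is
`b [d_/ξ] = [d_/f ∧ ξ]`; it is given here by its graph. -/
def RelB (f : HolFun (m + 1) t₀) (x y : EE f) : Prop :=
  ∃ ξ : Form f m, x = cls f (dRel f m ξ) ∧ y = cls f (dfWedge f m ξ)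

/-- `RelNabla f x y` says `y = ∇ x`. The operation `∇` is given here by its graph:
`∇ [d_/ξ] = [d_/f ∧ ∂ξ/∂t - (∂f/∂t) d_/ξ]`. -/
def RelNabla (f : HolFun (m + 1) t₀) (x y : EE f) : Prop :=
  ∃ ξ : Form f m, x = cls f (dRel f m ξ) ∧
    y = cls f (dfWedge f m (dirForm f m (eT (m + 1)) ξ)
      - toHat f (dirGerm (eT (m + 1)) (germ f)) • dRel f m ξ)

/-- `y = bᵏ x`. -/
def RelBPow (f : HolFun (m + 1) t₀) : ℕ → EE f → EE f → Prop
  | 0, x, y => x = y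
  | k + 1, x, y => ∃ w, RelBPow f k x w ∧ RelB f w y

/-- `IsSeriesAction f φ x y` says `y = (∑ φₖ(t) bᵏ) x`, as a `b`-adically convergent sum. -/
def IsSeriesAction (f : HolFun (m + 1) t₀) (φ : ℕ → HolD t₀) (x y : EE f) : Prop :=
  ∃ u : ℕ → EE f, u 0 = x ∧ (∀ k, RelB f (u k) (u (k + 1))) ∧
    ∀ K, ∃ w, RelBPow f K w (y - ∑ k ∈ Finset.range K, opT f (φ k) (u k))

/-- `N` is a sub-`𝒪_D⟦b⟧`-module of `𝔼`. An element of the stalk of `𝒪_D⟦b⟧` is a series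
`∑ φₖ bᵏ` whose coefficients are holomorphic in one common neighbourhood of `t₀`. -/
structure IsODbSubmodule (f : HolFun (m + 1) t₀) (N : AddSubgroup (EE f)) : Prop where
  smul_mem : ∀ (φ : HolD t₀), ∀ x ∈ N, opT f φ x ∈ N
  b_mem : ∀ x ∈ N, ∀ y, RelB f x y → y ∈ N
  series_mem : ∀ φ : ℕ → HolD t₀, (∃ U ∈ 𝓝 t₀, ∀ k, AnalyticOnNhd ℂ (φ k).1 U) →
    ∀ x ∈ N, ∀ y, IsSeriesAction f φ x y → y ∈ N

/-- `N` is a sub-`𝒪_D⟦b⟧`-module of `𝔼` that is stable by `a` and by `b⁻¹∇`; the latter means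
`∇ N ⊆ b N` (in particular `N` lies in the domain `{x | ∇ x ∈ b 𝔼}` of `b⁻¹∇`). -/
structure IsStable (f : HolFun (m + 1) t₀) (N : AddSubgroup (EE f)) : Prop
    extends IsODbSubmodule f N where
  a_mem : ∀ x ∈ N, opA f x ∈ N
  nabla_mem : ∀ x ∈ N, ∀ z, RelNabla f x z → ∃ y ∈ N, RelB f y z

/-- The largest sub-`𝒪_D⟦b⟧`-module `𝔾` of `𝔼` that is stable by `a` and `b⁻¹∇`. -/
def GG (f : HolFun (m + 1) t₀) : AddSubgroup (EE f) := sSup {N | IsStable f N}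

/-- `𝓜ᵏ`, the image in `𝔼` of `𝔐ᵏ` times the module of completed relative `n`-forms. -/
def calM (f : HolFun (m + 1) t₀) (k : ℕ) : AddSubgroup (EE f) :=
  (((idealM (m + 1) t₀) ^ k).map (toHat f) •
    (⊤ : Submodule (Hat f) (Form f (m + 1)))).toAddSubgroup.map (cls f)

end RelBrieskorn

end

/-! By maximality of `𝔾` it suffices to show that `𝓜ᵏ` is itself stable. Multiplication by `f` and
by functions of `t` is harmless. The rest depends on what `b` and `∇` do to the order along `{x =
0}`.

The radial homotopy `H` of the Poincaré lemma integrates along the segments from `(t, 0)` to `(t,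
x)` and contracts with `∑ xᵢ ∂/∂xᵢ`. The averages preserve `𝔐ᵏ` and the contraction contributes one
factor `xᵢ`, so `H` maps forms of order `k` to forms of order `k + 1`. Hence in positive degree a
form `ξ` with `d_/ξ` of order `k` equals `d_/η` plus a form of order `k + 1`. This passes to
completed forms: `f ∈ 𝔐`, so a completed form is holomorphic modulo any power of `𝔐`, and the
completion does not alter the order of a holomorphic germ (`exists_sub_dRel_mem`).

Since `d_/f ∧ d_/η = -d_/(d_/f ∧ η)` is a boundary, `b 𝓜ᵏ ⊆ 𝓜ᵏ⁺¹` (`calM_succ_of_relB`). So `bᵏ𝔼 ⊆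
𝓜ᵏ`, and a series in `b` applied to `𝓜ᵏ` is a finite sum in `𝓜ᵏ` plus a remainder in `bᵏ𝔼`.

For `∇`, the hypothesis gives `(∂f/∂t) d_/ξ = d_/f ∧ η` with `η` of order `k + 1`, whence `∇[d_/ξ] =
b[d_/(∂ξ/∂t - η)]`. Here `∂/∂t` preserves the order and `d_/` lowers it by at most one, so the class
on the right is in `𝓜ᵏ` (`exists_relB_of_relNabla`). -/

noncomputable section

namespace RelBrieskorn

variable {n : ℕ} {t₀ : ℂ}

/-! ## Weighted radial averages -/

/-- The linear map `(t, x) ↦ (t, s x)`. -/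
def fibreScale (n : ℕ) (s : ℝ) : (ℂ × (Fin n → ℂ)) →L[ℂ] (ℂ × (Fin n → ℂ)) :=
  (ContinuousLinearMap.fst ℂ ℂ (Fin n → ℂ)).prod ((s : ℂ) • ContinuousLinearMap.snd ℂ ℂ (Fin n → ℂ))

lemma fibreScale_apply (s : ℝ) (y : ℂ × (Fin n → ℂ)) :
    fibreScale n s y = (y.1, (s : ℂ) • y.2) := rfl

lemma fibreScale_base (s : ℝ) : fibreScale n s (t₀, 0) = (t₀, 0) := by
  simp [fibreScale_apply]

lemma norm_fibreScale_apply_le {s : ℝ} (hs : s ∈ Set.Icc (0 : ℝ) 1) (y : ℂ × (Fin n → ℂ)) :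
    ‖fibreScale n s y‖ ≤ ‖y‖ := by
  rw [fibreScale_apply, Prod.norm_def, Prod.norm_def, norm_smul, Complex.norm_real,
    Real.norm_of_nonneg hs.1]
  exact max_le_max le_rfl (mul_le_of_le_one_left (norm_nonneg _) hs.2)

lemma fibreScale_mem_ball {s : ℝ} (hs : s ∈ Set.Icc (0 : ℝ) 1) {y : ℂ × (Fin n → ℂ)} {r : ℝ}
    (hy : y ∈ Metric.ball (t₀, 0) r) : fibreScale n s y ∈ Metric.ball (t₀, 0) r := by
  rw [mem_ball_iff_norm] at hy ⊢
  rw [← fibreScale_base s, ← map_sub]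
  exact (norm_fibreScale_apply_le hs _).trans_lt hy

lemma continuous_fibreScale : Continuous (fibreScale n) := by
  have h : fibreScale n = fun s : ℝ => (fibreScale n 0) +
      (s : ℂ) • (fibreScale n 1 - fibreScale n 0) := by
    funext s
    refine ContinuousLinearMap.ext fun y => Prod.ext ?_ ?_ <;> simp [fibreScale_apply]
  rw [h]
  fun_prop

lemma continuous_fibreScale_apply (y : ℂ × (Fin n → ℂ)) :
    Continuous fun s => fibreScale n s y :=
  continuous_fibreScale.clm_apply continuous_const

/-- The weighted average of `g` over the segment from `(t, 0)` to `(t, x)`. -/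
def radialAverage (p : ℕ) (g : ℂ × (Fin n → ℂ) → ℂ) (y : ℂ × (Fin n → ℂ)) : ℂ :=
  ∫ s in (0 : ℝ)..1, (s : ℂ) ^ p * g (fibreScale n s y)

lemma continuousOn_radial {g : ℂ × (Fin n → ℂ) → ℂ} {r : ℝ}
    (hg : ContinuousOn g (Metric.ball (t₀, 0) r)) (p : ℕ) {y : ℂ × (Fin n → ℂ)}
    (hy : y ∈ Metric.ball (t₀, 0) r) :
    ContinuousOn (fun s : ℝ => (s : ℂ) ^ p * g (fibreScale n s y)) (Set.Icc 0 1) := by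
  refine ContinuousOn.mul (by fun_prop) ?_
  exact hg.comp (continuous_fibreScale_apply y).continuousOn
    fun s hs => fibreScale_mem_ball hs hy

lemma intervalIntegrable_radial {g : ℂ × (Fin n → ℂ) → ℂ} {r : ℝ}
    (hg : ContinuousOn g (Metric.ball (t₀, 0) r)) (p : ℕ) {y : ℂ × (Fin n → ℂ)}
    (hy : y ∈ Metric.ball (t₀, 0) r) :
    IntervalIntegrable (fun s : ℝ => (s : ℂ) ^ p * g (fibreScale n s y))
      MeasureTheory.volume 0 1 := by
  apply ContinuousOn.intervalIntegrable
  rw [Set.uIcc_of_le zero_le_one]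
  exact continuousOn_radial hg p hy

/-- The power series of `g` is integrated term by term. For `0 ≤ s ≤ 1` the scaling does not
increase norms, so the averaged coefficients `R k` are bounded by those of `g`, and the series
converges on the same ball. -/
lemma analyticAt_radialAverage (p : ℕ) {g : ℂ × (Fin n → ℂ) → ℂ}
    (hg : AnalyticAt ℂ g (t₀, 0)) : AnalyticAt ℂ (radialAverage p g) (t₀, 0) := by
  obtain ⟨P, r, hP⟩ := hg
  let Q (k : ℕ) (s : ℝ) : (ℂ × (Fin n → ℂ)) [×k]→L[ℂ] ℂ :=
    (s : ℂ) ^ p • (P k).compContinuousLinearMap fun _ => fibreScale n s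
  have hQc (k : ℕ) : Continuous (Q k) := by
    have h := ((ContinuousMultilinearMap.compContinuousLinearMapContinuousMultilinear ℂ
      (fun _ : Fin k => ℂ × (Fin n → ℂ)) (fun _ : Fin k => ℂ × (Fin n → ℂ)) ℂ).cont.comp
        (continuous_pi fun _ : Fin k => continuous_fibreScale (n := n))).clm_apply
          (continuous_const (y := P k))
    exact (by fun_prop : Continuous fun s : ℝ => (s : ℂ) ^ p).smul h
  have hnorm (k : ℕ) {s : ℝ} (hs : s ∈ Set.Icc (0 : ℝ) 1) : ‖Q k s‖ ≤ ‖P k‖ := by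
    refine ContinuousMultilinearMap.opNorm_le_bound (norm_nonneg _) fun v => ?_
    change ‖(s : ℂ) ^ p * P k fun i => fibreScale n s (v i)‖ ≤ _
    rw [norm_mul, norm_pow, Complex.norm_real, Real.norm_of_nonneg hs.1]
    refine (mul_le_of_le_one_left (norm_nonneg _) (pow_le_one₀ hs.1 hs.2)).trans ?_
    refine ((P k).le_opNorm _).trans ?_
    gcongr with i
    exact norm_fibreScale_apply_le hs _
  let R : FormalMultilinearSeries ℂ (ℂ × (Fin n → ℂ)) ℂ := fun k => ∫ s in (0 : ℝ)..1, Q k s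
  have hR (k : ℕ) : ‖R k‖ ≤ ‖P k‖ := by
    have := intervalIntegral.norm_integral_le_of_norm_le_const (a := 0) (b := 1) (f := Q k)
      (C := ‖P k‖) fun s hs => by
        rw [Set.uIoc_of_le zero_le_one] at hs
        exact hnorm k ⟨hs.1.le, hs.2⟩
    simpa using this
  refine ⟨R, r, ?_, hP.r_pos, ?_⟩
  · exact hP.r_le.trans (FormalMultilinearSeries.radius_le_of_le hR)
  · intro y hy
    have hRy (k : ℕ) : R k (fun _ => y) = ∫ s in (0 : ℝ)..1, Q k s fun _ => y := by
      have := (ContinuousMultilinearMap.apply ℂ (fun _ : Fin k => ℂ × (Fin n → ℂ)) ℂ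
        (fun _ => y)).intervalIntegral_comp_comm ((hQc k).intervalIntegrable (μ := MeasureTheory.volume) 0 1)
      exact this.symm
    simp only [hRy]
    have hyr : y ∈ Metric.eball (0 : ℂ × (Fin n → ℂ)) P.radius :=
      Metric.eball_subset_eball hP.r_le hy
    refine intervalIntegral.hasSum_integral_of_dominated_convergence
      (fun k _ => ‖P k‖ * ‖y‖ ^ k) (fun k => ?_) (fun k => ?_) ?_ ?_ ?_
    · exact (((ContinuousMultilinearMap.apply ℂ (fun _ : Fin k => ℂ × (Fin n → ℂ)) ℂ
        (fun _ => y)).continuous.comp (hQc k))).aestronglyMeasurable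
    · refine Eventually.of_forall fun s hs => ?_
      rw [Set.uIoc_of_le zero_le_one] at hs
      refine ((Q k s).le_opNorm _).trans ?_
      simp only [Finset.prod_const, Finset.card_univ, Fintype.card_fin]
      gcongr
      exact hnorm k ⟨hs.1.le, hs.2⟩
    · refine Eventually.of_forall fun s _ => ?_
      have := P.summable_norm_mul_pow (r := ‖y‖₊) (by simpa [enorm_eq_nnnorm] using hyr)
      simpa using this
    · simp
    · refine Eventually.of_forall fun s hs => ?_
      rw [Set.uIoc_of_le zero_le_one] at hs
      have hs' : s ∈ Set.Icc (0 : ℝ) 1 := ⟨hs.1.le, hs.2⟩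
      have hsy : fibreScale n s y ∈ Metric.eball (0 : ℂ × (Fin n → ℂ)) r := by
        have h1 : ‖fibreScale n s y‖ₑ ≤ ‖y‖ₑ := by
          rw [enorm_le_iff_norm_le]
          exact norm_fibreScale_apply_le hs' y
        simp only [Metric.mem_eball, edist_zero_right] at hy ⊢
        exact h1.trans_lt hy
      have := (hP.hasSum hsy).mul_left ((s : ℂ) ^ p)
      rw [map_add, fibreScale_base]
      exact this

/-- Weighted averages of holomorphic functions. -/
def radialFun (p : ℕ) (g : HolFun n t₀) : HolFun n t₀ :=
  ⟨radialAverage p g.1, analyticAt_radialAverage p g.2⟩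

lemma exists_ball (g : HolFun n t₀) : ∃ r > 0, AnalyticOnNhd ℂ g.1 (Metric.ball (t₀, 0) r) := by
  obtain ⟨U, hU, h⟩ := exists_analyticOnNhd g
  obtain ⟨r, hr, hr'⟩ := Metric.mem_nhds_iff.1 hU
  exact ⟨r, hr, h.mono hr'⟩

/-- A ball around `(t₀, 0)` contains the segment from `(t, 0)` to each of its points `(t, x)`, so
the average there only sees values on the ball. -/
lemma germ_radialFun_congr (p : ℕ) {g h : HolFun n t₀} (H : germ g = germ h) :
    germ (radialFun p g) = germ (radialFun p h) := by
  rw [germ_eq_iff] at H ⊢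
  obtain ⟨r, hr, hr'⟩ := Metric.mem_nhds_iff.1 H
  filter_upwards [Metric.ball_mem_nhds _ hr] with y hy
  refine intervalIntegral.integral_congr fun s hs => ?_
  rw [Set.uIcc_of_le zero_le_one] at hs
  have : g.1 (fibreScale n s y) = h.1 (fibreScale n s y) := hr' (fibreScale_mem_ball hs hy)
  simp only [this]

lemma germ_radialFun_add (p : ℕ) (g h : HolFun n t₀) :
    germ (radialFun p (g + h)) = germ (radialFun p g) + germ (radialFun p h) := by
  rw [← map_add, germ_eq_iff]
  obtain ⟨r, hr, hg⟩ := exists_ball g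
  obtain ⟨q, hq, hh⟩ := exists_ball h
  filter_upwards [Metric.ball_mem_nhds _ hr, Metric.ball_mem_nhds _ hq] with y hy hy'
  change (∫ s in (0 : ℝ)..1, (s : ℂ) ^ p * (g.1 (fibreScale n s y) + h.1 (fibreScale n s y)))
    = (∫ s in (0 : ℝ)..1, _) + ∫ s in (0 : ℝ)..1, _
  rw [← intervalIntegral.integral_add (intervalIntegrable_radial hg.continuousOn p hy)
    (intervalIntegrable_radial hh.continuousOn p hy')]
  simp only [mul_add]

/-- Weighted averages of germs. -/
def radialGerm (p : ℕ) : HolGerm n t₀ →+ HolGerm n t₀ :=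
  AddMonoidHom.mk'
    (Quotient.lift (fun g => germ (radialFun p g)) fun g h H =>
      germ_radialFun_congr p (Quotient.sound H))
    (by
      rintro ⟨g⟩ ⟨h⟩
      exact germ_radialFun_add p g h)

lemma radialGerm_germ (p : ℕ) (g : HolFun n t₀) :
    radialGerm p (germ g) = germ (radialFun p g) := rfl

/-- On the segment `xᵢ` becomes `s xᵢ`; the factor `s` goes into the weight. -/
lemma radialGerm_coordX_mul (p : ℕ) (i : Fin n) (g : HolGerm n t₀) :
    radialGerm p (germ (coordX t₀ i) * g) = germ (coordX t₀ i) * radialGerm (p + 1) g := by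
  obtain ⟨g, rfl⟩ := germ_surjective g
  rw [← map_mul, radialGerm_germ, radialGerm_germ, ← map_mul]
  congr 1
  apply Subtype.ext
  funext y
  change (∫ s in (0 : ℝ)..1, (s : ℂ) ^ p * (((s : ℂ) * y.2 i) * g.1 (fibreScale n s y))) =
    y.2 i * ∫ s in (0 : ℝ)..1, (s : ℂ) ^ (p + 1) * g.1 (fibreScale n s y)
  rw [← intervalIntegral.integral_const_mul]
  congr 1
  funext s
  ring

/-- Each factor `xᵢ` can be pulled out at the cost of a higher weight, which is why the induction
runs over all weights at once. -/
lemma radialGerm_mem_pow (k : ℕ) {g : HolGerm n t₀} (hg : g ∈ idealM n t₀ ^ k) (p : ℕ) :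
    radialGerm p g ∈ idealM n t₀ ^ k := by
  induction k generalizing g p with
  | zero => simp
  | succ k ih =>
    rw [pow_succ'] at hg ⊢
    refine Submodule.mul_induction_on hg (fun x hx h hh => ?_) fun a b ha hb => ?_
    · induction hx using Submodule.span_induction generalizing h with
      | mem x hx =>
        obtain ⟨i, rfl⟩ := hx
        simp only
        rw [radialGerm_coordX_mul]
        exact Ideal.mul_mem_mul (Ideal.subset_span ⟨i, rfl⟩) (ih hh _)
      | zero => simp
      | add x y _ _ hx hy =>
        rw [add_mul, map_add]
        exact add_mem (hx _ hh) (hy _ hh)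
      | smul a x _ hx =>
        rw [smul_eq_mul, mul_comm a x, mul_assoc]
        exact hx _ (Ideal.mul_mem_left _ _ hh)
    · rw [map_add]
      exact add_mem ha hb

/-- Differentiation under the integral; the chain rule produces the extra factor `s`. -/
lemma dirGerm_eX_radialGerm (p : ℕ) (i : Fin n) (g : HolGerm n t₀) :
    dirGerm (eX i) (radialGerm p g) = radialGerm (p + 1) (dirGerm (eX i) g) := by
  obtain ⟨g, rfl⟩ := germ_surjective g
  rw [radialGerm_germ, dirGerm_germ, dirGerm_germ, radialGerm_germ, germ_eq_iff]
  obtain ⟨r, hr, hg⟩ := exists_ball g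
  have hgd : AnalyticAt ℂ (fderiv ℂ g.1) (t₀, 0) := AnalyticAt.fderiv g.2
  -- On a small ball the derivative stays below its norm at the centre plus one; this constant
  -- dominates the integrand.
  obtain ⟨q, hq, hb⟩ := Metric.mem_nhds_iff.1
    (hgd.continuousAt.norm.eventually (gt_mem_nhds (lt_add_one _)))
  set C := ‖fderiv ℂ g.1 (t₀, 0)‖ + 1
  obtain ⟨r', hr', hr1, hr2⟩ : ∃ r' > 0, r' ≤ r ∧ r' ≤ q :=
    ⟨min r q, lt_min hr hq, min_le_left _ _, min_le_right _ _⟩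
  replace hg := hg.mono (Metric.ball_subset_ball hr1)
  replace hb : ∀ y ∈ Metric.ball (t₀, 0) r', ‖fderiv ℂ g.1 y‖ ≤ C := fun y hy =>
    (hb (Metric.ball_subset_ball hr2 hy)).le
  filter_upwards [Metric.ball_mem_nhds _ hr'] with y hy
  let F' (y : ℂ × (Fin n → ℂ)) (s : ℝ) : (ℂ × (Fin n → ℂ)) →L[ℂ] ℂ :=
    (s : ℂ) ^ p • (fderiv ℂ g.1 (fibreScale n s y)).comp (fibreScale n s)
  have hF' : ContinuousOn (F' y) (Set.Icc 0 1) := by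
    refine ContinuousOn.smul (f := fun s : ℝ => (s : ℂ) ^ p) (by fun_prop) (ContinuousOn.clm_comp ?_
      continuous_fibreScale.continuousOn)
    exact hg.fderiv.continuousOn.comp (continuous_fibreScale_apply y).continuousOn
      fun s hs => fibreScale_mem_ball hs hy
  have key : HasFDerivAt (radialAverage p g.1) (∫ s in (0 : ℝ)..1, F' y s) y := by
    refine intervalIntegral.hasFDerivAt_integral_of_dominated_of_fderiv_le (bound := fun _ => C)
      (Metric.isOpen_ball.mem_nhds hy) ?_ ?_ ?_ ?_ ?_ ?_
    · filter_upwards [Metric.isOpen_ball.mem_nhds hy] with z hz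
      exact (intervalIntegrable_radial hg.continuousOn p hz).aestronglyMeasurable_restrict_uIoc
    · exact intervalIntegrable_radial hg.continuousOn p hy
    · rw [Set.uIoc_of_le zero_le_one]
      exact (hF'.mono Set.Ioc_subset_Icc_self).aestronglyMeasurable measurableSet_Ioc
    · refine Eventually.of_forall fun s hs z hz => ?_
      rw [Set.uIoc_of_le zero_le_one] at hs
      have hs' : s ∈ Set.Icc (0 : ℝ) 1 := ⟨hs.1.le, hs.2⟩
      rw [norm_smul, norm_pow, Complex.norm_real, Real.norm_of_nonneg hs'.1]
      refine (mul_le_of_le_one_left (norm_nonneg _) (pow_le_one₀ hs'.1 hs'.2)).trans ?_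
      refine (ContinuousLinearMap.opNorm_comp_le _ _).trans ?_
      refine (mul_le_of_le_one_right (norm_nonneg _) ?_).trans (hb _ (fibreScale_mem_ball hs' hz))
      exact ContinuousLinearMap.opNorm_le_bound _ zero_le_one fun v => by
        rw [one_mul]; exact norm_fibreScale_apply_le hs' v
    · simp
    · refine Eventually.of_forall fun s hs z hz => ?_
      rw [Set.uIoc_of_le zero_le_one] at hs
      have hs' : s ∈ Set.Icc (0 : ℝ) 1 := ⟨hs.1.le, hs.2⟩
      exact (((hg _ (fibreScale_mem_ball hs' hz)).differentiableAt.hasFDerivAt.comp z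
        (fibreScale n s).hasFDerivAt).const_mul _ :)
  change fderiv ℂ (radialAverage p g.1) y (eX i) =
    ∫ s in (0 : ℝ)..1, (s : ℂ) ^ (p + 1) * fderiv ℂ g.1 (fibreScale n s y) (eX i)
  have hint : IntervalIntegrable (F' y) MeasureTheory.volume 0 1 := by
    apply ContinuousOn.intervalIntegrable
    rwa [Set.uIcc_of_le zero_le_one]
  rw [key.fderiv, ContinuousLinearMap.intervalIntegral_apply hint]
  congr 1
  funext s
  have : fibreScale n s (eX i) = (s : ℂ) • eX i := by
    simp [fibreScale_apply, eX]
  simp [F', this]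
  ring

/-- Integration of `d/ds (s ^ p * g (t, s x))` over `0 ≤ s ≤ 1`. -/
lemma sum_coord_mul_radialAverage (p : ℕ) {g : ℂ × (Fin n → ℂ) → ℂ} {r : ℝ}
    (hg : AnalyticOnNhd ℂ g (Metric.ball (t₀, 0) r)) {y : ℂ × (Fin n → ℂ)}
    (hy : y ∈ Metric.ball (t₀, 0) r) :
    ∑ i, y.2 i * radialAverage p (fun z => fderiv ℂ g z (eX i)) y
      + p * radialAverage (p - 1) g y = g y - 0 ^ p * g (y.1, 0) := by
  have hc (i : Fin n) : ContinuousOn (fun z => fderiv ℂ g z (eX i)) (Metric.ball (t₀, 0) r) :=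
    hg.fderiv.continuousOn.clm_apply continuousOn_const
  have hi (i : Fin n) := (intervalIntegrable_radial (hc i) p hy).const_mul (y.2 i)
  have hi' := (intervalIntegrable_radial hg.continuousOn (p - 1) hy).const_mul (p : ℂ)
  have hs := IntervalIntegrable.sum Finset.univ fun i _ => hi i
  rw [Finset.sum_fn] at hs
  unfold radialAverage
  simp only [← intervalIntegral.integral_const_mul]
  rw [← intervalIntegral.integral_finsetSum fun i _ => hi i,
    ← intervalIntegral.integral_add hs hi']
  have h0 : (0 : ℂ) ^ p * g (y.1, 0) = ((0 : ℝ) : ℂ) ^ p * g (fibreScale n 0 y) := by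
    simp [fibreScale_apply]
  have h1 : g y = ((1 : ℝ) : ℂ) ^ p * g (fibreScale n 1 y) := by
    simp [fibreScale_apply]
  rw [h0, h1]
  refine intervalIntegral.integral_eq_sub_of_hasDerivAt
    (f := fun s : ℝ => (s : ℂ) ^ p * g (fibreScale n s y)) (fun s hs => ?_) ?_
  · rw [Set.uIcc_of_le zero_le_one] at hs
    have hA : HasDerivAt (fun s : ℝ => fibreScale n s y) (0, y.2) s := by
      refine HasDerivAt.prodMk (hasDerivAt_const _ _) ?_
      simpa using (Complex.ofRealCLM.hasDerivAt (x := s)).smul_const y.2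
    have hgs := ((hg _ (fibreScale_mem_ball hs hy)).differentiableAt.hasFDerivAt.restrictScalars
      ℝ).comp_hasDerivAt s hA
    have hp : HasDerivAt (fun s : ℝ => (s : ℂ) ^ p) (p * (s : ℂ) ^ (p - 1)) s := by
      simpa using (Complex.ofRealCLM.hasDerivAt (x := s)).fun_pow p
    refine (hp.mul hgs).congr_deriv ?_
    have hv : ((0, y.2) : ℂ × (Fin n → ℂ)) = ∑ i, y.2 i • eX i := by
      ext j
      · simp [eX, Prod.fst_sum]
      · simp [eX, Prod.snd_sum, Pi.single_apply]
    simp only [ContinuousLinearMap.coe_restrictScalars']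
    rw [hv, map_sum, Finset.mul_sum, add_comm]
    congr 1
    · refine Finset.sum_congr rfl fun i _ => ?_
      rw [map_smul, smul_eq_mul]
      ring
    · simp only [Function.comp_apply]
      ring
  · exact hs.add hi'

/-- The weight `p + 1` is positive, so the boundary term at `s = 0` vanishes. -/
lemma sum_coordX_radialGerm (p : ℕ) (g : HolGerm n t₀) :
    ∑ i, germ (coordX t₀ i) * radialGerm (p + 1) (dirGerm (eX i) g)
      + ((p : HolGerm n t₀) + 1) * radialGerm p g = g := by
  obtain ⟨g, rfl⟩ := germ_surjective g
  simp only [dirGerm_germ, radialGerm_germ, ← map_mul, ← map_sum, ← map_natCast germ,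
    ← map_one germ, ← map_add]
  rw [germ_eq_iff]
  obtain ⟨r, hr, hg⟩ := exists_ball g
  filter_upwards [Metric.ball_mem_nhds _ hr] with y hy
  have h := sum_coord_mul_radialAverage (p + 1) hg hy
  simp only [add_tsub_cancel_right, zero_pow p.succ_ne_zero, zero_mul, sub_zero] at h
  rw [← h]
  simp only [Subring.coe_add, Subring.coe_mul, AddSubmonoidClass.coe_finsetSum, Pi.add_apply,
    Finset.sum_apply, Pi.mul_apply]
  push_cast
  rfl

/-- Hadamard's lemma. -/
lemma germ_mem_idealM {g : HolFun n t₀}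
    (hg : ∀ᶠ y in 𝓝 ((t₀, 0) : ℂ × (Fin n → ℂ)), y.2 = 0 → g.1 y = 0) :
    germ g ∈ idealM n t₀ := by
  -- Weight `0`: now the boundary term at `s = 0` is `g (t, 0)`, which vanishes by hypothesis.
  have key : germ g = ∑ i, germ (coordX t₀ i) * radialGerm 0 (dirGerm (eX i) (germ g)) := by
    simp only [dirGerm_germ, radialGerm_germ, ← map_mul, ← map_sum]
    rw [germ_eq_iff]
    obtain ⟨r, hr, hr'⟩ := exists_ball g
    obtain ⟨q, hq, hq'⟩ := Metric.mem_nhds_iff.1 hg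
    filter_upwards [Metric.ball_mem_nhds _ hr, Metric.ball_mem_nhds _ hq] with y hy hyq
    have h := sum_coord_mul_radialAverage 0 hr' hy
    have h0 : g.1 (y.1, 0) = 0 := by
      refine hq' ?_ rfl
      have := fibreScale_mem_ball (s := 0) (by simp) hyq
      simpa [fibreScale_apply] using this
    simp only [h0, Nat.cast_zero, zero_mul, add_zero, mul_zero, sub_zero] at h
    rw [← h]
    simp only [Subring.coe_mul, AddSubmonoidClass.coe_finsetSum, Finset.sum_apply, Pi.mul_apply]
    rfl
  rw [key]
  exact sum_mem fun i _ => Ideal.mul_mem_right _ _ (Ideal.subset_span ⟨i, rfl⟩)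

lemma dirGerm_comm (v w : ℂ × (Fin n → ℂ)) (g : HolGerm n t₀) :
    dirGerm v (dirGerm w g) = dirGerm w (dirGerm v g) := by
  obtain ⟨g, rfl⟩ := germ_surjective g
  simp only [dirGerm_germ]
  rw [germ_eq_iff]
  have hg : AnalyticAt ℂ g.1 (t₀, 0) := g.2
  filter_upwards [hg.eventually_analyticAt] with y hy
  have h (u u' : ℂ × (Fin n → ℂ)) : fderiv ℂ (fun z => fderiv ℂ g.1 z u) y u' =
      fderiv ℂ (fderiv ℂ g.1) y u' u := by
    rw [fderiv_clm_apply hy.fderiv.differentiableAt (differentiableAt_const _)]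
    simp
  change fderiv ℂ (fun z => fderiv ℂ g.1 z w) y v = fderiv ℂ (fun z => fderiv ℂ g.1 z v) y w
  rw [h, h]
  exact (hy.contDiffAt.isSymmSndFDerivAt_of_omega).eq v w

/-! ## The ideal of `{x = 0}` in the formal completion -/

/-- By the Leibniz rule a derivation destroys at most one factor. -/
lemma map_pow_succ_mem {R : Type*} [CommRing R] (D : R →+ R)
    (hD : ∀ a b, D (a * b) = a * D b + D a * b) (I : Ideal R) (k : ℕ) {r : R}
    (hr : r ∈ I ^ (k + 1)) : D r ∈ I ^ k := by
  induction k generalizing r with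
  | zero => simp
  | succ k ih =>
    rw [pow_succ] at hr
    refine Submodule.mul_induction_on hr (fun a ha b hb => ?_) fun a b ha hb => ?_
    · rw [hD]
      refine add_mem (Ideal.mul_mem_right _ _ ha) ?_
      rw [pow_succ]
      exact Ideal.mul_mem_mul (ih ha) hb
    · rw [map_add]
      exact add_mem ha hb

lemma map_pow_mem {R : Type*} [CommRing R] (D : R →+ R)
    (hD : ∀ a b, D (a * b) = a * D b + D a * b) (I : Ideal R) (hI : ∀ r ∈ I, D r ∈ I)
    (k : ℕ) {r : R} (hr : r ∈ I ^ k) : D r ∈ I ^ k := by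
  induction k generalizing r with
  | zero => simp
  | succ k ih =>
    rw [pow_succ] at hr ⊢
    refine Submodule.mul_induction_on hr (fun a ha b hb => ?_) fun a b ha hb => ?_
    · rw [hD]
      exact add_mem (Ideal.mul_mem_mul ha (hI _ hb)) (Ideal.mul_mem_mul (ih ha) hb)
    · rw [map_add]
      exact add_mem ha hb

/-- The extension of `𝔐` to the formal completion. -/
def hatM (f : HolFun n t₀) : Ideal (Hat f) := (idealM n t₀).map (toHat f)

lemma hatM_pow (f : HolFun n t₀) (k : ℕ) : hatM f ^ k = (idealM n t₀ ^ k).map (toHat f) :=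
  (Ideal.map_pow _ _ _).symm

lemma dirHat_mem_hatM_pow (f : HolFun n t₀) (v : ℂ × (Fin n → ℂ)) (k : ℕ) {r : Hat f}
    (hr : r ∈ hatM f ^ (k + 1)) : dirHat f v r ∈ hatM f ^ k :=
  map_pow_succ_mem _ (dirHat_mul f v) _ k hr

lemma dirGerm_eT_coordX (i : Fin n) : dirGerm (eT n) (germ (coordX t₀ i)) = 0 := by
  rw [dirGerm_germ, ← map_zero germ, germ_eq_iff]
  refine Eventually.of_forall fun y => ?_
  change fderiv ℂ ((ContinuousLinearMap.proj i : (Fin n → ℂ) →L[ℂ] ℂ).comp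
      (ContinuousLinearMap.snd ℂ ℂ (Fin n → ℂ))) y (eT n) = 0
  rw [ContinuousLinearMap.fderiv]
  simp [eT]

lemma dirGerm_eX_coordX (i j : Fin n) :
    dirGerm (eX j) (germ (coordX t₀ i)) = if i = j then 1 else 0 := by
  have : (if i = j then 1 else 0 : HolGerm n t₀) = germ (if i = j then 1 else 0) := by
    split_ifs <;> simp
  rw [dirGerm_germ, this, germ_eq_iff]
  refine Eventually.of_forall fun y => ?_
  change fderiv ℂ ((ContinuousLinearMap.proj i : (Fin n → ℂ) →L[ℂ] ℂ).comp
      (ContinuousLinearMap.snd ℂ ℂ (Fin n → ℂ))) y (eX j) = _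
  rw [ContinuousLinearMap.fderiv]
  by_cases h : i = j
  · subst h
    simp [eX]
  · simp [eX, h]

/-- The generators `xᵢ` do not depend on `t`, so `∂/∂t` preserves the ideal they generate and all
its powers. -/
lemma dirHat_eT_mem_hatM_pow (f : HolFun n t₀) (k : ℕ) {r : Hat f}
    (hr : r ∈ hatM f ^ k) : dirHat f (eT n) r ∈ hatM f ^ k := by
  refine map_pow_mem _ (dirHat_mul f _) _ (fun r hr => ?_) k hr
  rw [hatM, idealM, Ideal.map_span] at hr ⊢
  induction hr using Submodule.span_induction with
  | mem x hx =>
    obtain ⟨_, ⟨i, rfl⟩, rfl⟩ := hx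
    rw [dirHat_toHat, dirGerm_eT_coordX, map_zero]
    exact zero_mem _
  | zero => simp
  | add x y _ _ hx hy =>
    rw [map_add]
    exact add_mem hx hy
  | smul a x hx hx' =>
    rw [smul_eq_mul, dirHat_mul]
    exact add_mem (Ideal.mul_mem_left _ _ hx') (Ideal.mul_mem_left _ _ hx)

lemma mkHat_zSeries (f : HolFun n t₀) : mkHat f (zSeries n t₀) = toHat f (germ f) :=
  Ideal.Quotient.eq.2 (Ideal.subset_span rfl)

lemma mkHat_surjective (f : HolFun n t₀) : Function.Surjective (mkHat f) :=
  Ideal.Quotient.mk_surjective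

lemma coe_constSeries (g : HolGerm n t₀) : (constSeries g).1 = PowerSeries.C g := rfl

lemma coe_zSeries : (zSeries n t₀).1 = PowerSeries.X := rfl

lemma mk_coeff_succ_mem (F : UnifSeries n t₀) :
    (PowerSeries.mk fun j => PowerSeries.coeff (j + 1) F.1) ∈ UnifSeries n t₀ := by
  obtain ⟨U, hU, h⟩ := F.2
  exact ⟨U, hU, fun j => by simpa only [PowerSeries.coeff_mk] using h (j + 1)⟩

lemma exists_eq_constSeries_add (F : UnifSeries n t₀) :
    ∃ g G, F = constSeries g + zSeries n t₀ * G := by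
  refine ⟨PowerSeries.constantCoeff F.1, ⟨_, mk_coeff_succ_mem F⟩, Subtype.ext ?_⟩
  rw [Subring.coe_add, Subring.coe_mul, coe_constSeries, coe_zSeries, add_comm]
  exact PowerSeries.eq_X_mul_shift_add_const F.1

lemma exists_eq_toHat_add (f : HolFun n t₀) (h : Hat f) :
    ∃ g h', h = toHat f g + toHat f (germ f) * h' := by
  obtain ⟨F, rfl⟩ := mkHat_surjective f h
  obtain ⟨g, G, rfl⟩ := exists_eq_constSeries_add F
  exact ⟨g, mkHat f G, by rw [map_add, map_mul, mkHat_zSeries]; rfl⟩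

/-- Truncation of the series in powers of `f`. -/
lemma exists_sub_toHat_mem (f : HolFun n t₀) (hf : germ f ∈ idealM n t₀) (l : ℕ) (h : Hat f) :
    ∃ g, h - toHat f g ∈ hatM f ^ l := by
  induction l generalizing h with
  | zero => exact ⟨0, by simp⟩
  | succ l ih =>
    obtain ⟨g, h', rfl⟩ := exists_eq_toHat_add f h
    obtain ⟨g', hg'⟩ := ih h'
    refine ⟨g + germ f * g', ?_⟩
    have : toHat f g + toHat f (germ f) * h' - toHat f (g + germ f * g')
        = toHat f (germ f) * (h' - toHat f g') := by
      rw [map_add, map_mul]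
      ring
    rw [this, pow_succ']
    exact Ideal.mul_mem_mul (Ideal.mem_map_of_mem _ hf) hg'

/-- With `qⱼ` the coefficients of `Q`, the hypothesis says `g + f q₀ ∈ Iᵏ` and `qⱼ - f qⱼ₊₁ ∈ Iᵏ`.
Telescoping gives `g + fʲ⁺¹ qⱼ ∈ Iᵏ` for all `j`, and for `j = k` the second summand is in `Iᵏ`
because `f ∈ I`. -/
lemma mem_of_const_sub_mem {R : Type*} [CommRing R] (I : Ideal R) (k : ℕ) {f g : R} (hf : f ∈ I)
    (Q : PowerSeries R)
    (h : ∀ j, PowerSeries.coeff j (PowerSeries.C g - Q * (PowerSeries.X - PowerSeries.C f))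
      ∈ I ^ k) : g ∈ I ^ k := by
  have key (j : ℕ) : g + f ^ (j + 1) * PowerSeries.coeff j Q ∈ I ^ k := by
    induction j with
    | zero => simpa [mul_comm, mul_sub] using h 0
    | succ j ih =>
      have h1 := h (j + 1)
      simp only [mul_sub, map_sub, PowerSeries.coeff_C, PowerSeries.coeff_succ_mul_X,
        PowerSeries.coeff_mul_C, Nat.succ_ne_zero, if_false, zero_sub] at h1
      have : g + f ^ (j + 1 + 1) * PowerSeries.coeff (j + 1) Q =
          (g + f ^ (j + 1) * PowerSeries.coeff j Q) + f ^ (j + 1) *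
            -(PowerSeries.coeff j Q - PowerSeries.coeff (j + 1) Q * f) := by ring
      rw [this]
      exact add_mem ih (Ideal.mul_mem_left _ _ h1)
  have h2 : f ^ (k + 1) * PowerSeries.coeff k Q ∈ I ^ k :=
    Ideal.mul_mem_right _ _ (Ideal.pow_le_pow_right k.le_succ (Ideal.pow_mem_pow hf _))
  simpa using sub_mem (key k) h2

/-- An element of `hatM f ^ k` is represented by a series with all coefficients in `𝔐ᵏ`. It differs
from the constant series `g` by a multiple of `z - f`, so `mem_of_const_sub_mem` applies. -/
lemma mem_idealM_pow_of_toHat_mem (f : HolFun n t₀) (hf : germ f ∈ idealM n t₀) (k : ℕ)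
    {g : HolGerm n t₀} (hg : toHat f g ∈ hatM f ^ k) : g ∈ idealM n t₀ ^ k := by
  have key : ∀ h ∈ hatM f ^ k, ∃ F : UnifSeries n t₀, mkHat f F = h ∧
      ∀ j, PowerSeries.coeff j F.1 ∈ idealM n t₀ ^ k := by
    intro h hh
    rw [hatM_pow] at hh
    induction hh using Submodule.span_induction with
    | mem x hx =>
      obtain ⟨q, hq, rfl⟩ := hx
      refine ⟨constSeries q, rfl, fun j => ?_⟩
      change PowerSeries.coeff j (PowerSeries.C q) ∈ _
      rw [PowerSeries.coeff_C]
      split_ifs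
      · exact hq
      · exact zero_mem _
    | zero => exact ⟨0, map_zero _, fun j => by simp⟩
    | add x y _ _ hx hy =>
      obtain ⟨F, rfl, hF⟩ := hx
      obtain ⟨G, rfl, hG⟩ := hy
      exact ⟨F + G, map_add _ _ _, fun j => by simpa using add_mem (hF j) (hG j)⟩
    | smul a x _ hx =>
      obtain ⟨A, rfl⟩ := mkHat_surjective f a
      obtain ⟨F, rfl, hF⟩ := hx
      refine ⟨A * F, map_mul _ _ _, fun j => ?_⟩
      rw [Subring.coe_mul, PowerSeries.coeff_mul]
      exact sum_mem fun p _ => Ideal.mul_mem_left _ _ (hF _)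
  obtain ⟨F, hF, hFk⟩ := key _ hg
  have hd : constSeries g - F ∈ zIdeal f := Ideal.Quotient.eq.1 hF.symm
  obtain ⟨Q, hQ⟩ := Ideal.mem_span_singleton'.1 hd
  refine mem_of_const_sub_mem _ k hf Q.1 fun j => ?_
  have : F.1 = PowerSeries.C g - Q.1 * (PowerSeries.X - PowerSeries.C (germ f)) := by
    have h1 : F = constSeries g - Q * (zSeries n t₀ - constSeries (germ f)) := by
      rw [hQ]
      ring
    exact congrArg Subtype.val h1
  rw [← this]
  exact hFk j

lemma dirHat_comm (f : HolFun n t₀) (v w : ℂ × (Fin n → ℂ)) (r : Hat f) :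
    dirHat f v (dirHat f w r) = dirHat f w (dirHat f v r) := by
  obtain ⟨F, rfl⟩ := mkHat_surjective f r
  simp only [dirHat_mk]
  congr 1
  apply Subtype.ext
  change dirPow f v (dirPow f w F.1) = dirPow f w (dirPow f v F.1)
  have hnat (u : ℂ × (Fin n → ℂ)) (k : ℕ) : dirGerm u ((k : HolGerm n t₀) + 1) = 0 := by
    have : ((k : HolGerm n t₀) + 1) = (k + 1) • (1 : HolGerm n t₀) := by simp
    rw [this, map_nsmul, dirGerm_one, smul_zero]
  ext k
  simp only [dirPow, PowerSeries.coeff_mk, map_add, dirGerm_mul, hnat]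
  rw [dirGerm_comm v w, dirGerm_comm v w (germ f)]
  ring

/-! ## Forms of arbitrary degree -/

section Exterior

variable {R : Type*} [CommRing R]

/-- The product `dxᵢ ∧ ω` on forms `∑ ω_I dx_I` of mixed degree. -/
def wedge (R : Type*) [CommRing R] (i : Fin n) :
    (Finset (Fin n) → R) →ₗ[R] (Finset (Fin n) → R) where
  toFun ω I := if i ∈ I then (-1) ^ (I.filter (· < i)).card * ω (I.erase i) else 0
  map_add' ω η := by
    ext I
    by_cases h : i ∈ I <;> simp [h, mul_add]
  map_smul' r ω := by
    ext I
    by_cases h : i ∈ I <;> simp [h, mul_left_comm]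

/-- The contraction with `∂/∂xᵢ` on forms of mixed degree. -/
def contract (R : Type*) [CommRing R] (i : Fin n) :
    (Finset (Fin n) → R) →ₗ[R] (Finset (Fin n) → R) where
  toFun ω I := if i ∈ I then 0 else (-1) ^ (I.filter (· < i)).card * ω (insert i I)
  map_add' ω η := by
    ext I
    by_cases h : i ∈ I <;> simp [h, mul_add]
  map_smul' r ω := by
    ext I
    by_cases h : i ∈ I <;> simp [h, mul_left_comm]

lemma wedge_apply (i : Fin n) (ω : Finset (Fin n) → R) (I : Finset (Fin n)) :
    wedge R i ω I = if i ∈ I then (-1) ^ (I.filter (· < i)).card * ω (I.erase i) else 0 := rfl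

lemma contract_apply (i : Fin n) (ω : Finset (Fin n) → R) (I : Finset (Fin n)) :
    contract R i ω I =
      if i ∈ I then 0 else (-1) ^ (I.filter (· < i)).card * ω (insert i I) := rfl

lemma card_filter_erase_of_lt {i j : Fin n} {I : Finset (Fin n)} (hj : j ∈ I) (h : j < i) :
    (I.filter (· < i)).card = ((I.erase j).filter (· < i)).card + 1 := by
  rw [Finset.filter_erase, Finset.card_erase_add_one]
  simp [hj, h]

lemma filter_erase_of_le {i j : Fin n} (I : Finset (Fin n)) (h : i ≤ j) :
    (I.erase j).filter (· < i) = I.filter (· < i) := by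
  rw [Finset.filter_erase, Finset.erase_eq_of_notMem]
  simp [h]

lemma wedge_contract_self (i : Fin n) (ω : Finset (Fin n) → R) (I : Finset (Fin n)) :
    wedge R i (contract R i ω) I = if i ∈ I then ω I else 0 := by
  rw [wedge_apply]
  split_ifs with h
  · rw [contract_apply, if_neg (Finset.notMem_erase _ _), filter_erase_of_le I le_rfl,
      Finset.insert_erase h, ← mul_assoc, ← mul_pow]
    simp
  · rfl

lemma contract_wedge_self (i : Fin n) (ω : Finset (Fin n) → R) (I : Finset (Fin n)) :
    contract R i (wedge R i ω) I = if i ∈ I then 0 else ω I := by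
  rw [contract_apply]
  split_ifs with h
  · rfl
  · have := filter_erase_of_le (insert i I) (le_refl i)
    rw [Finset.erase_insert h] at this
    rw [wedge_apply, if_pos (Finset.mem_insert_self _ _), ← this, Finset.erase_insert h,
      ← mul_assoc, ← mul_pow]
    simp

/-- The Clifford relation. For `i ≠ j` the two orders of operation differ by one transposition:
exactly one of the two sign counts changes, and by one. -/
lemma wedge_contract_add (i j : Fin n) (ω : Finset (Fin n) → R) :
    wedge R j (contract R i ω) + contract R i (wedge R j ω) = if i = j then ω else 0 := by
  split_ifs with hij
  · subst hij
    ext I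
    rw [Pi.add_apply, wedge_contract_self, contract_wedge_self]
    split_ifs <;> simp
  ext I
  rw [Pi.add_apply, wedge_apply, contract_apply, contract_apply, wedge_apply]
  by_cases hj : j ∈ I
  · by_cases hi : i ∈ I
    · simp [hi, hj, hij]
    · have hi' : i ∉ I.erase j := fun h => hi (Finset.mem_of_mem_erase h)
      have hj' : j ∈ insert i I := Finset.mem_insert_of_mem hj
      rw [if_pos hj, if_neg hi', if_neg hi, if_pos hj', Finset.erase_insert_of_ne hij,
        ← mul_assoc, ← mul_assoc, ← pow_add, ← pow_add, ← add_mul]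
      rcases lt_or_gt_of_ne hij with h | h
      · rw [filter_erase_of_le I h.le, card_filter_erase_of_lt (Finset.mem_insert_self i I) h,
          Finset.erase_insert hi]
        simp [pow_add, mul_comm]
      · have h1 := filter_erase_of_le (insert i I) h.le
        rw [Finset.erase_insert hi] at h1
        rw [← h1, card_filter_erase_of_lt hj h]
        simp [pow_add, mul_comm]
  · simp [hj, Ne.symm hij]

lemma wedge_wedge (i j : Fin n) (ω : Finset (Fin n) → R) :
    wedge R i (wedge R j ω) + wedge R j (wedge R i ω) = 0 := by
  wlog hij : i ≤ j generalizing i j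
  · rw [add_comm]
    exact this j i (le_of_not_ge hij)
  rcases hij.eq_or_lt with rfl | hij
  · ext I
    simp [wedge_apply]
  ext I
  simp only [Pi.add_apply, wedge_apply]
  by_cases hi : i ∈ I
  · by_cases hj : j ∈ I
    · rw [if_pos hi, if_pos hj, if_pos (Finset.mem_erase.2 ⟨hij.ne', hj⟩),
        if_pos (Finset.mem_erase.2 ⟨hij.ne, hi⟩), Finset.erase_right_comm,
        card_filter_erase_of_lt hi hij, filter_erase_of_le I hij.le]
      simp only [pow_succ, Pi.zero_apply]
      ring
    · simp [hj]
  · simp [hi]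

lemma sum_wedge_contract (ω : Finset (Fin n) → R) (I : Finset (Fin n)) :
    ∑ i, wedge R i (contract R i ω) I = I.card * ω I := by
  simp only [wedge_contract_self]
  rw [← Finset.sum_filter]
  simp

end Exterior

/-! ## The Poincaré lemma for holomorphic relative forms -/

/-- Holomorphic relative forms of mixed degree. -/
abbrev GermForm (n : ℕ) (t₀ : ℂ) : Type := Finset (Fin n) → HolGerm n t₀

/-- The derivative of the coefficients of a form. -/
def dirGermForm (v : ℂ × (Fin n → ℂ)) (ω : GermForm n t₀) : GermForm n t₀ :=
  fun I => dirGerm v (ω I)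

/-- The relative differential of holomorphic forms. -/
def dGerm (ω : GermForm n t₀) : GermForm n t₀ :=
  ∑ i, wedge _ i (dirGermForm (eX i) ω)

/-- Radial averages of the coefficients, with the weights of the radial homotopy. -/
def radialForm (ω : GermForm n t₀) : GermForm n t₀ :=
  fun I => radialGerm (I.card - 1) (ω I)

/-- The radial homotopy. -/
def radialHomotopy (ω : GermForm n t₀) : GermForm n t₀ :=
  ∑ i, germ (coordX t₀ i) • contract _ i (radialForm ω)

lemma map_neg_one_pow_mul {A B : Type*} [CommRing A] [CommRing B] (φ : A →+ B) (k : ℕ) (a : A) :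
    φ ((-1) ^ k * a) = (-1) ^ k * φ a := by
  rcases neg_one_pow_eq_or A k with h | h <;> rcases Nat.even_or_odd k with hk | hk <;>
    simp [hk.neg_one_pow]

lemma dirGermForm_contract (v : ℂ × (Fin n → ℂ)) (i : Fin n) (ω : GermForm n t₀) :
    dirGermForm v (contract _ i ω) = contract _ i (dirGermForm v ω) := by
  ext I
  simp only [dirGermForm, contract_apply]
  split_ifs
  · exact map_zero _
  · rw [map_neg_one_pow_mul]

/-- Cartan's formula for the Euler field `∑ xᵢ ∂/∂xᵢ`, integrated along the segments. -/
lemma dGerm_radialHomotopy (ω : GermForm n t₀) (I : Finset (Fin n)) (hI : 1 ≤ I.card) :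
    dGerm (radialHomotopy ω) I + radialHomotopy (dGerm ω) I = ω I := by
  -- The first summand comes from `∂xᵢ/∂xⱼ = δᵢⱼ`.
  have h1 (j : Fin n) : dirGermForm (eX j) (radialHomotopy ω) =
      contract _ j (radialForm ω) + ∑ i, germ (coordX t₀ i) •
        contract _ i (dirGermForm (eX j) (radialForm ω)) := by
    ext J
    simp only [← dirGermForm_contract]
    simp only [dirGermForm, radialHomotopy, Finset.sum_apply, Pi.smul_apply, smul_eq_mul, map_sum,
      dirGerm_mul, dirGerm_eX_coordX, Finset.sum_add_distrib, Pi.add_apply]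
    rw [add_comm]
    congr 1
    simp
  -- The weight `|J| - 1` makes the averages commute with `d_/`: a derivative raises both the degree
  -- and the weight by one. The subtraction is truncated, so this needs `|I| ≥ 1`.
  have h2 : radialHomotopy (dGerm ω) I = ∑ j, ∑ i, germ (coordX t₀ i) *
      contract _ i (wedge _ j (dirGermForm (eX j) (radialForm ω))) I := by
    rw [Finset.sum_comm]
    simp only [radialHomotopy, Finset.sum_apply, Pi.smul_apply, smul_eq_mul, ← Finset.mul_sum]
    refine Finset.sum_congr rfl fun i _ => ?_
    congr 1
    simp only [contract_apply]
    split_ifs with hi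
    · simp
    rw [← Finset.mul_sum]
    congr 1
    simp only [radialForm, dGerm, Finset.sum_apply, map_sum, wedge_apply]
    refine Finset.sum_congr rfl fun j _ => ?_
    split_ifs with hj
    · rw [map_neg_one_pow_mul]
      congr 1
      simp only [dirGermForm, radialForm]
      rw [dirGerm_eX_radialGerm, Finset.card_erase_of_mem hj, Finset.card_insert_of_notMem hi]
      congr 2
      omega
    · exact map_zero _
  rw [h2]
  simp only [dGerm, h1, map_add, map_sum, map_smul, Finset.sum_apply, Pi.add_apply,
    Pi.smul_apply, smul_eq_mul]
  rw [← Finset.sum_add_distrib]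
  -- By the Clifford relation only the terms `i = j` survive, giving the derivative along the Euler
  -- field.
  have h3 (j : Fin n) : wedge _ j (contract _ j (radialForm ω)) I +
      ∑ i, germ (coordX t₀ i) * wedge _ j (contract _ i (dirGermForm (eX j) (radialForm ω))) I +
      ∑ i, germ (coordX t₀ i) * contract _ i (wedge _ j (dirGermForm (eX j) (radialForm ω))) I =
      wedge _ j (contract _ j (radialForm ω)) I + germ (coordX t₀ j) *
        dirGerm (eX j) (radialForm ω I) := by
    rw [add_assoc, ← Finset.sum_add_distrib]
    congr 1
    rw [Finset.sum_eq_single j]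
    · rw [← mul_add, ← Pi.add_apply, wedge_contract_add, if_pos rfl]
      rfl
    · intro i _ hij
      rw [← mul_add, ← Pi.add_apply, wedge_contract_add, if_neg hij, Pi.zero_apply, mul_zero]
    · simp
  simp only [h3]
  rw [Finset.sum_add_distrib, sum_wedge_contract, add_comm]
  -- The sum of the `wedge`–`contract` terms multiplies by the degree `p + 1`, the coefficient
  -- needed in `sum_coordX_radialGerm`.
  obtain ⟨p, hp⟩ : ∃ p, I.card = p + 1 := ⟨I.card - 1, by omega⟩
  have h4 := sum_coordX_radialGerm p (ω I)
  simp only [radialForm, hp, dirGerm_eX_radialGerm, Nat.add_sub_cancel]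
  push_cast
  exact h4

lemma radialHomotopy_mem (k : ℕ) (ω : GermForm n t₀) (p : ℕ)
    (hω : ∀ I, I.card = p + 1 → ω I ∈ idealM n t₀ ^ k) (I : Finset (Fin n)) (hI : I.card = p) :
    radialHomotopy ω I ∈ idealM n t₀ ^ (k + 1) := by
  simp only [radialHomotopy, Finset.sum_apply, Pi.smul_apply, smul_eq_mul]
  refine sum_mem fun i _ => ?_
  rw [pow_succ']
  refine Ideal.mul_mem_mul (Ideal.subset_span ⟨i, rfl⟩) ?_
  rw [contract_apply]
  split_ifs with hi
  · exact zero_mem _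
  · exact Ideal.mul_mem_left _ _ (radialGerm_mem_pow k
      (hω _ (by rw [Finset.card_insert_of_notMem hi, hI])) _)

/-! ## Completed forms -/

/-- The component of degree `p`. -/
def toForm (f : HolFun n t₀) (p : ℕ) : (Finset (Fin n) → Hat f) →ₗ[Hat f] Form f p where
  toFun ω I := ω I.1
  map_add' _ _ := rfl
  map_smul' _ _ := rfl

lemma toForm_surjective (f : HolFun n t₀) (p : ℕ) : Function.Surjective (toForm f p) := by
  intro ω
  refine ⟨fun I => if h : I.card = p then ω ⟨I, h⟩ else 0, ?_⟩
  ext I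
  exact dif_pos I.2

lemma dxWedge_toForm (f : HolFun n t₀) (p : ℕ) (i : Fin n) (ω : Finset (Fin n) → Hat f) :
    dxWedge f p i (toForm f p ω) = toForm f (p + 1) (wedge _ i ω) := by
  ext I
  change (if h : i ∈ I.1 then _ else _) = wedge _ i ω I.1
  rw [wedge_apply]
  split_ifs <;> rfl

/-- The completed form of degree `p` defined by a holomorphic form. -/
def ofGermForm (f : HolFun n t₀) (p : ℕ) (ω : GermForm n t₀) : Form f p :=
  toForm f p fun I => toHat f (ω I)

lemma dRel_ofGermForm (f : HolFun n t₀) (p : ℕ) (ω : GermForm n t₀) :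
    dRel f p (ofGermForm f p ω) = ofGermForm f (p + 1) (dGerm ω) := by
  have h (i : Fin n) : dirForm f p (eX i) (ofGermForm f p ω) =
      ofGermForm f p (dirGermForm (eX i) ω) := by
    ext I
    exact dirHat_toHat f (eX i) (ω I.1)
  simp only [dRel, AddMonoidHom.finsetSum_apply, AddMonoidHom.comp_apply,
    LinearMap.toAddMonoidHom_coe, h]
  ext I
  simp only [Finset.sum_apply, ofGermForm, dxWedge_toForm, dGerm]
  change ∑ i, wedge _ i (fun J => toHat f (dirGermForm (eX i) ω J)) I.1 =
    toHat f (∑ i, wedge _ i (dirGermForm (eX i) ω) I.1)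
  rw [map_sum]
  refine Finset.sum_congr rfl fun i _ => ?_
  simp only [wedge_apply]
  split_ifs <;> simp

/-- Forms all of whose coefficients lie in `𝔐ᵏ`. -/
def formM (f : HolFun n t₀) (p k : ℕ) : Submodule (Hat f) (Form f p) :=
  hatM f ^ k • ⊤

lemma mem_formM {f : HolFun n t₀} {p k : ℕ} {ω : Form f p} :
    ω ∈ formM f p k ↔ ∀ I, ω I ∈ hatM f ^ k := by
  constructor
  · intro h I
    refine Submodule.smul_induction_on h (fun r hr η _ => Ideal.mul_mem_right _ _ hr)
      fun a b ha hb => add_mem ha hb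
  · intro h
    have : ω = ∑ I, ω I • (Pi.single I 1 : Form f p) := by
      ext J
      simp [Pi.single_apply]
    rw [this]
    exact sum_mem fun I _ => Submodule.smul_mem_smul (h I) trivial

lemma dxWedge_mem_formM {f : HolFun n t₀} {p k : ℕ} (i : Fin n) {ω : Form f p}
    (hω : ω ∈ formM f p k) : dxWedge f p i ω ∈ formM f (p + 1) k := by
  refine (Submodule.map_smul'' (hatM f ^ k) ⊤ (dxWedge f p i)).le.trans
    (smul_mono_right _ le_top) (Submodule.mem_map_of_mem hω)

lemma dRel_mem_formM {f : HolFun n t₀} {p k : ℕ} {ω : Form f p}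
    (hω : ω ∈ formM f p (k + 1)) : dRel f p ω ∈ formM f (p + 1) k := by
  simp only [dRel, AddMonoidHom.finsetSum_apply, AddMonoidHom.comp_apply,
    LinearMap.toAddMonoidHom_coe]
  exact sum_mem fun i _ => dxWedge_mem_formM i
    (mem_formM.2 fun I => dirHat_mem_hatM_pow f _ _ (mem_formM.1 hω I))

lemma dfWedge_mem_formM {f : HolFun n t₀} {p k : ℕ} {ω : Form f p}
    (hω : ω ∈ formM f p k) : dfWedge f p ω ∈ formM f (p + 1) k :=
  (Submodule.map_smul'' (hatM f ^ k) ⊤ (dfWedge f p)).le.trans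
    (smul_mono_right _ le_top) (Submodule.mem_map_of_mem hω)

/-- A form whose differential lies in `𝔐ᵏ` is exact modulo `𝔐ᵏ⁺¹`. -/
lemma exists_sub_dRel_mem (f : HolFun n t₀) (hf : germ f ∈ idealM n t₀) (p k : ℕ)
    (ξ : Form f (p + 1)) (hξ : dRel f (p + 1) ξ ∈ formM f (p + 2) k) :
    ∃ η : Form f p, ξ - dRel f p η ∈ formM f (p + 1) (k + 1) := by
  obtain ⟨ξ', rfl⟩ := toForm_surjective f _ ξ
  -- Truncation at order `k + 1` replaces `ξ` by a holomorphic form `ω`; the error is allowed in the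
  -- conclusion and its differential still has order `k`.
  choose g hg using exists_sub_toHat_mem f hf (k + 1)
  set ω : GermForm n t₀ := fun I => g (ξ' I)
  have hω : toForm f (p + 1) ξ' - ofGermForm f (p + 1) ω ∈ formM f (p + 1) (k + 1) :=
    mem_formM.2 fun I => hg _
  have hdω (I : Finset (Fin n)) (hI : I.card = p + 2) : dGerm ω I ∈ idealM n t₀ ^ k := by
    have h := sub_mem hξ (dRel_mem_formM hω)
    rw [map_sub, sub_sub_cancel, dRel_ofGermForm] at h
    exact mem_idealM_pow_of_toHat_mem f hf k (mem_formM.1 h ⟨I, hI⟩)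
  refine ⟨ofGermForm f p (radialHomotopy ω), ?_⟩
  rw [dRel_ofGermForm, ← sub_add_sub_cancel _ (ofGermForm f (p + 1) ω)]
  refine add_mem hω (mem_formM.2 fun I => ?_)
  -- What remains, `ω - d_/Hω = H d_/ω`, has order `k + 1`.
  have h := dGerm_radialHomotopy ω I.1 (by rw [I.2]; omega)
  change toHat f (ω I.1) - toHat f (dGerm (radialHomotopy ω) I.1) ∈ _
  rw [← map_sub, ← h, add_sub_cancel_left, hatM_pow]
  exact Ideal.mem_map_of_mem _ (radialHomotopy_mem k _ (p + 1) hdω _ I.2)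

/-! ## Identities between the operators on completed forms -/

lemma dxWedge_dxWedge_add (f : HolFun n t₀) (p : ℕ) (i j : Fin n) (ω : Form f p) :
    dxWedge f (p + 1) i (dxWedge f p j ω) + dxWedge f (p + 1) j (dxWedge f p i ω) = 0 := by
  obtain ⟨ω, rfl⟩ := toForm_surjective f p ω
  simp only [dxWedge_toForm]
  rw [← map_add, wedge_wedge, map_zero]

lemma dxWedge_dxWedge_self (f : HolFun n t₀) (p : ℕ) (i : Fin n) (ω : Form f p) :
    dxWedge f (p + 1) i (dxWedge f p i ω) = 0 := by
  obtain ⟨ω, rfl⟩ := toForm_surjective f p ω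
  have : wedge (Hat f) i (wedge (Hat f) i ω) = 0 := by
    ext I
    simp [wedge_apply]
  rw [dxWedge_toForm, dxWedge_toForm, this, map_zero]

/-- Symmetric coefficients against an alternating product: `(i, j)` cancels `(j, i)`, and diagonal
terms vanish. -/
lemma sum_smul_dxWedge_dxWedge (f : HolFun n t₀) (p : ℕ) (c : Fin n → Fin n → Hat f)
    (hc : ∀ i j, c i j = c j i) (ω : Form f p) :
    ∑ i, ∑ j, c i j • dxWedge f (p + 1) i (dxWedge f p j ω) = 0 := by
  rw [← Finset.sum_product']
  refine Finset.sum_involution (fun q _ => q.swap) (fun q _ => ?_) (fun q _ hq hs => hq ?_)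
    (fun _ _ => by simp) (fun _ _ => by simp)
  · rw [Prod.fst_swap, Prod.snd_swap, hc q.2 q.1, ← smul_add, dxWedge_dxWedge_add, smul_zero]
  · have : q.2 = q.1 := congrArg Prod.fst hs
    rw [this, dxWedge_dxWedge_self, smul_zero]

lemma dfWedge_apply (f : HolFun n t₀) (p : ℕ) (ω : Form f p) :
    dfWedge f p ω = ∑ i, toHat f (dirGerm (eX i) (germ f)) • dxWedge f p i ω := by
  simp only [dfWedge, LinearMap.sum_apply, LinearMap.smul_apply]

lemma dRel_apply (f : HolFun n t₀) (p : ℕ) (ω : Form f p) :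
    dRel f p ω = ∑ i, dxWedge f p i (dirForm f p (eX i) ω) := by
  simp only [dRel, AddMonoidHom.finsetSum_apply, AddMonoidHom.comp_apply,
    LinearMap.toAddMonoidHom_coe]

lemma dirForm_smul (f : HolFun n t₀) (p : ℕ) (v : ℂ × (Fin n → ℂ)) (r : Hat f) (ω : Form f p) :
    dirForm f p v (r • ω) = r • dirForm f p v ω + dirHat f v r • ω := by
  ext I
  exact dirHat_mul f v r (ω I)

lemma dirForm_dxWedge (f : HolFun n t₀) (p : ℕ) (v : ℂ × (Fin n → ℂ)) (i : Fin n)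
    (ω : Form f p) :
    dirForm f (p + 1) v (dxWedge f p i ω) = dxWedge f p i (dirForm f p v ω) := by
  ext I
  change dirHat f v (if h : i ∈ I.1 then _ else 0) = if h : i ∈ I.1 then _ else 0
  split_ifs with h
  · exact map_neg_one_pow_mul _ _ _
  · exact map_zero _

lemma dirForm_comm (f : HolFun n t₀) (p : ℕ) (v w : ℂ × (Fin n → ℂ)) (ω : Form f p) :
    dirForm f p v (dirForm f p w ω) = dirForm f p w (dirForm f p v ω) := by
  ext I
  exact dirHat_comm f v w (ω I)

lemma dirForm_dRel (f : HolFun n t₀) (p : ℕ) (v : ℂ × (Fin n → ℂ)) (ω : Form f p) :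
    dirForm f (p + 1) v (dRel f p ω) = dRel f p (dirForm f p v ω) := by
  simp only [dRel_apply, map_sum, dirForm_dxWedge, dirForm_comm f p v]

lemma dirForm_dfWedge (f : HolFun n t₀) (p : ℕ) (v : ℂ × (Fin n → ℂ)) (ω : Form f p) :
    dirForm f (p + 1) v (dfWedge f p ω) = dfWedge f p (dirForm f p v ω) +
      ∑ i, dirHat f (eX i) (toHat f (dirGerm v (germ f))) • dxWedge f p i ω := by
  simp only [dfWedge_apply, map_sum, dirForm_smul, dirForm_dxWedge, Finset.sum_add_distrib,
    dirHat_toHat, dirGerm_comm v]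

lemma dfWedge_dfWedge (f : HolFun n t₀) (p : ℕ) (ω : Form f p) :
    dfWedge f (p + 1) (dfWedge f p ω) = 0 := by
  simp only [dfWedge_apply, map_sum, map_smul, Finset.smul_sum, smul_smul]
  rw [Finset.sum_comm]
  exact sum_smul_dxWedge_dxWedge f p (fun i j => toHat f (dirGerm (eX j) (germ f)) *
    toHat f (dirGerm (eX i) (germ f))) (fun i j => mul_comm _ _) ω

lemma dRel_dfWedge (f : HolFun n t₀) (p : ℕ) (ω : Form f p) :
    dRel f (p + 1) (dfWedge f p ω) = -dfWedge f (p + 1) (dRel f p ω) := by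
  rw [← add_eq_zero_iff_eq_neg, dRel_apply]
  simp only [dirForm_dfWedge, map_add, Finset.sum_add_distrib]
  -- This term is `d_/d_/f ∧ ω`; it vanishes by symmetry of the Hessian.
  have h : ∑ i, dxWedge f (p + 1) i (∑ j, dirHat f (eX j)
      (toHat f (dirGerm (eX i) (germ f))) • dxWedge f p j ω) = 0 := by
    simp only [map_sum, map_smul]
    exact sum_smul_dxWedge_dxWedge f p (fun i j => dirHat f (eX j)
      (toHat f (dirGerm (eX i) (germ f))))
      (fun i j => by simp only [dirHat_toHat, dirGerm_comm (eX i)]) ω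
  rw [h, add_zero]
  simp only [dRel_apply, dfWedge_apply, map_sum, map_smul]
  simp only [← Finset.sum_add_distrib, ← smul_add, dxWedge_dxWedge_add, smul_zero,
    Finset.sum_const_zero]

lemma dirForm_eT_mem_formM {f : HolFun n t₀} {p k : ℕ} {ω : Form f p}
    (hω : ω ∈ formM f p k) : dirForm f p (eT n) ω ∈ formM f p k :=
  mem_formM.2 fun I => dirHat_eT_mem_hatM_pow f k (mem_formM.1 hω I)

lemma formM_anti (f : HolFun n t₀) (p : ℕ) {k l : ℕ} (h : k ≤ l) : formM f p l ≤ formM f p k :=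
  Submodule.smul_mono_left (Ideal.pow_le_pow_right h)

/-! ## Stability of `𝓜ᵏ` -/

variable {m : ℕ}

/-- The primitive is the contraction of `θ` with `∂/∂xᵢ`. As `θ` has top degree, `dxⱼ ∧ θ = 0`, and
the Clifford relation gives `dxⱼ ∧ ιᵢθ = δᵢⱼ θ`. -/
lemma mem_range_dfWedge (f : HolFun (m + 1) t₀) (i : Fin (m + 1)) (θ : Form f (m + 1)) :
    toHat f (dirGerm (eX i) (germ f)) • θ ∈ LinearMap.range (dfWedge f m) := by
  obtain ⟨θ, rfl⟩ := toForm_surjective f _ θ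
  refine ⟨toForm f m (contract _ i θ), ?_⟩
  rw [dfWedge_apply]
  have hc (j : Fin (m + 1)) : dxWedge f m j (toForm f m (contract _ i θ)) =
      if i = j then toForm f (m + 1) θ else 0 := by
    have h := congrArg (toForm f (m + 1)) (wedge_contract_add i j θ)
    have h0 : toForm f (m + 1) (contract _ i (wedge _ j θ)) = 0 := by
      ext I
      have hI : i ∈ I.1 := by
        rw [(Finset.card_eq_iff_eq_univ I.1).1 (by rw [I.2, Fintype.card_fin])]
        exact Finset.mem_univ i
      exact if_pos hI
    rw [map_add, h0, add_zero] at h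
    rw [dxWedge_toForm, h]
    split_ifs <;> simp
  simp [hc]

lemma relJac_smul_le_range (f : HolFun (m + 1) t₀) :
    (relJac f).map (toHat f) • (⊤ : Submodule (Hat f) (Form f (m + 1))) ≤
      LinearMap.range (dfWedge f m) := by
  rw [relJac, Ideal.map_span]
  refine Submodule.smul_le.2 fun r hr θ _ => ?_
  induction hr using Submodule.span_induction with
  | mem x hx =>
    obtain ⟨_, ⟨i, rfl⟩, rfl⟩ := hx
    exact mem_range_dfWedge f i θ
  | zero => simp
  | add x y _ _ hx hy =>
    rw [add_smul]
    exact add_mem hx hy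
  | smul a x _ hx =>
    rw [smul_assoc]
    exact Submodule.smul_mem _ _ hx

/-- Since `J_/(f) Ω̂ⁿ ⊆ d_/f ∧ Ω̂ⁿ⁻¹` and `d_/f ∧ ·` is linear, the factor `𝔐ᵏ⁺¹` of the hypothesis
can be placed on the primitive. -/
lemma exists_dfWedge_eq_smul (f : HolFun (m + 1) t₀) (g : HolGerm (m + 1) t₀) (k : ℕ)
    (hk : idealM (m + 1) t₀ ^ k * Ideal.span {g} ≤ idealM (m + 1) t₀ ^ (k + 1) * relJac f)
    {ω : Form f (m + 1)} (hω : ω ∈ formM f (m + 1) k) :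
    ∃ η ∈ formM f m (k + 1), dfWedge f m η = toHat f g • ω := by
  have h1 : toHat f g • ω ∈ (Ideal.span {g}).map (toHat f) • formM f (m + 1) k :=
    Submodule.smul_mem_smul (Ideal.mem_map_of_mem _ (Ideal.subset_span rfl)) hω
  have h2 : (Ideal.span {g}).map (toHat f) • formM f (m + 1) k ≤
      (formM f m (k + 1)).map (dfWedge f m) := by
    calc (Ideal.span {g}).map (toHat f) • formM f (m + 1) k
        = (idealM (m + 1) t₀ ^ k * Ideal.span {g}).map (toHat f) • ⊤ := by
          rw [formM, ← Submodule.mul_smul, hatM_pow, ← Ideal.map_mul, mul_comm]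
      _ ≤ (idealM (m + 1) t₀ ^ (k + 1) * relJac f).map (toHat f) • ⊤ :=
          Submodule.smul_mono_left (Ideal.map_mono hk)
      _ = hatM f ^ (k + 1) • ((relJac f).map (toHat f) • ⊤) := by
          rw [← Submodule.mul_smul, hatM_pow, ← Ideal.map_mul]
      _ ≤ hatM f ^ (k + 1) • LinearMap.range (dfWedge f m) :=
          smul_mono_right _ (relJac_smul_le_range f)
      _ = (formM f m (k + 1)).map (dfWedge f m) := by
          rw [formM, Submodule.map_smul'', Submodule.map_top]
  exact h2 h1

lemma mem_calM {f : HolFun (m + 1) t₀} {k : ℕ} {x : EE f} :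
    x ∈ calM f k ↔ ∃ ω ∈ formM f (m + 1) k, cls f ω = x := by
  rw [calM, ← hatM_pow]
  rfl

lemma cls_eq_zero {f : HolFun (m + 1) t₀} {ω : Form f (m + 1)} :
    cls f ω = 0 ↔ ∃ κ, dfWedge f m κ = 0 ∧ dRel f m κ = ω :=
  QuotientAddGroup.eq_zero_iff ω

lemma calM_anti (f : HolFun (m + 1) t₀) {k l : ℕ} (h : k ≤ l) : calM f l ≤ calM f k := by
  intro x hx
  obtain ⟨ω, hω, rfl⟩ := mem_calM.1 hx
  exact mem_calM.2 ⟨ω, formM_anti f _ h hω, rfl⟩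

/-- Membership of the class controls `d_/ξ` only up to a boundary `d_/κ`; subtracting `κ` controls
the form itself. -/
lemma exists_dRel_sub_mem {f : HolFun (m + 1) t₀} {k : ℕ} {ξ : Form f m}
    (h : cls f (dRel f m ξ) ∈ calM f k) :
    ∃ κ, dfWedge f m κ = 0 ∧ dRel f m (ξ - κ) ∈ formM f (m + 1) k := by
  obtain ⟨ω, hω, h⟩ := mem_calM.1 h
  have h0 : cls f (dRel f m ξ - ω) = 0 := by rw [map_sub, h, sub_self]
  obtain ⟨κ, hκ, hκ'⟩ := cls_eq_zero.1 h0
  refine ⟨κ, hκ, ?_⟩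
  rwa [map_sub, hκ', sub_sub_cancel]

/-- The operation `b` maps `𝓜ᵏ` to `𝓜ᵏ⁺¹`. -/
lemma calM_succ_of_relB (hm : 1 ≤ m) {f : HolFun (m + 1) t₀} (hf : germ f ∈ idealM (m + 1) t₀)
    {k : ℕ} {x y : EE f} (hx : x ∈ calM f k) (hxy : RelB f x y) : y ∈ calM f (k + 1) := by
  -- Here `n ≥ 2` enters: `ξ` has degree `n - 1 ≥ 1`, as the Poincaré lemma requires.
  obtain ⟨p, rfl⟩ : ∃ p, m = p + 1 := ⟨m - 1, by omega⟩
  obtain ⟨ξ, rfl, rfl⟩ := hxy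
  obtain ⟨κ, hκ, hξ⟩ := exists_dRel_sub_mem hx
  obtain ⟨η, hη⟩ := exists_sub_dRel_mem f hf p k _ hξ
  refine mem_calM.2 ⟨_, dfWedge_mem_formM hη, ?_⟩
  rw [← sub_eq_zero, ← map_sub, cls_eq_zero]
  -- The discarded `-d_/f ∧ d_/η` equals `d_/(d_/f ∧ η)`, and `d_/f ∧ η` is killed by `d_/f ∧ ·`.
  refine ⟨dfWedge f p η, dfWedge_dfWedge f p η, ?_⟩
  rw [dRel_dfWedge, map_sub (dfWedge f (p + 1)), map_sub (dfWedge f (p + 1)), hκ]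
  abel

lemma calM_of_relBPow (hm : 1 ≤ m) {f : HolFun (m + 1) t₀} (hf : germ f ∈ idealM (m + 1) t₀)
    (k : ℕ) {x y : EE f} (h : RelBPow f k x y) : y ∈ calM f k := by
  induction k generalizing y with
  | zero =>
    obtain ⟨ω, rfl⟩ := QuotientAddGroup.mk'_surjective (boundaries f) y
    exact mem_calM.2 ⟨ω, mem_formM.2 fun I => by simp, rfl⟩
  | succ k ih =>
    obtain ⟨w, hw, hwy⟩ := h
    exact calM_succ_of_relB hm hf (ih hw) hwy

lemma opT_mem_calM {f : HolFun (m + 1) t₀} {k : ℕ} (φ : HolD t₀) {x : EE f}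
    (hx : x ∈ calM f k) : opT f φ x ∈ calM f k := by
  obtain ⟨ω, hω, rfl⟩ := mem_calM.1 hx
  exact mem_calM.2 ⟨_, Submodule.smul_mem _ (toHat f (germ (pullT (m + 1) φ))) hω, rfl⟩

lemma opA_mem_calM {f : HolFun (m + 1) t₀} {k : ℕ} {x : EE f}
    (hx : x ∈ calM f k) : opA f x ∈ calM f k := by
  obtain ⟨ω, hω, rfl⟩ := mem_calM.1 hx
  exact mem_calM.2 ⟨_, Submodule.smul_mem _ (toHat f (germ f)) hω, rfl⟩

lemma exists_relB_of_relNabla {f : HolFun (m + 1) t₀} {k : ℕ}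
    (hk : idealM (m + 1) t₀ ^ k * Ideal.span {dirGerm (eT (m + 1)) (germ f)} ≤
      idealM (m + 1) t₀ ^ (k + 1) * relJac f)
    {x z : EE f} (hx : x ∈ calM f k) (hxz : RelNabla f x z) : ∃ y ∈ calM f k, RelB f y z := by
  obtain ⟨ξ, rfl, rfl⟩ := hxz
  obtain ⟨κ, hκ, hξ⟩ := exists_dRel_sub_mem hx
  obtain ⟨η, hη, hη'⟩ := exists_dfWedge_eq_smul f _ k hk hξ
  -- The candidate for `b⁻¹∇x`, with `ξ` corrected by `κ` and `η` absorbing the term `(∂f/∂t) d_/(ξ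
  -- - κ)`.
  refine ⟨cls f (dRel f m (dirForm f m (eT (m + 1)) (ξ - κ) - η)), ?_, _, rfl, ?_⟩
  · rw [map_sub, ← dirForm_dRel]
    exact mem_calM.2 ⟨_, sub_mem (dirForm_eT_mem_formM hξ) (dRel_mem_formM hη), rfl⟩
  · rw [← sub_eq_zero, ← map_sub, cls_eq_zero]
    set c := toHat f (dirGerm (eT (m + 1)) (germ f)) with hc
    have h := dirForm_dfWedge f m (eT (m + 1)) κ
    rw [hκ, map_zero, ← hc] at h
    -- Replacing `ξ` by `ξ - κ` changes the value of `∇` by a boundary: applying `∂/∂t` to `d_/f ∧ κ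
    -- = 0` gives `d_/f ∧ ∂κ/∂t - c d_/κ = -d_/(c κ)`.
    refine ⟨-(c • κ), by rw [map_neg, map_smul, hκ, smul_zero, neg_zero], ?_⟩
    rw [map_neg, dRel_smul]
    rw [map_sub (dfWedge f m), hη', map_sub (dirForm f m _), map_sub (dfWedge f m),
      map_sub (dRel f m), smul_sub]
    rw [eq_neg_of_add_eq_zero_left h.symm]
    abel

end RelBrieskorn

end

/-! ### The stability of `𝓜ᵏ` and its inclusion in `𝔾` -/

open RelBrieskorn in
theorem proposition4p2p1 (m : ℕ) (hm : 1 ≤ m) (t₀ : ℂ) (f : RelBrieskorn.HolFun (m + 1) t₀)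
    -- near `(t₀, 0)` the singular locus `{f = 0, df = 0}` is `{x = 0}`
    (hS : ∀ᶠ y in 𝓝 ((t₀, 0) : ℂ × (Fin (m + 1) → ℂ)),
      (f.1 y = 0 ∧ fderiv ℂ f.1 y = 0) ↔ y.2 = 0)
    -- near `(t₀, 0)` the critical locus of `(f, t)` is `{x = 0}` as well
    (hSigma : ∀ᶠ y in 𝓝 ((t₀, 0) : ℂ × (Fin (m + 1) → ℂ)),
      (∀ i, fderiv ℂ f.1 y (RelBrieskorn.eX i) = 0) ↔ y.2 = 0)
    (k : ℕ)
    (hk : RelBrieskorn.idealM (m + 1) t₀ ^ k *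
        Ideal.span {RelBrieskorn.dirGerm (RelBrieskorn.eT (m + 1)) (RelBrieskorn.germ f)} ≤
      RelBrieskorn.idealM (m + 1) t₀ ^ (k + 1) * RelBrieskorn.relJac f) :
    RelBrieskorn.calM f k ≤ RelBrieskorn.GG f := by
  have hf : germ f ∈ idealM (m + 1) t₀ :=
    germ_mem_idealM (hS.mono fun y hy h => (hy.2 h).1)
  refine le_sSup (a := calM f k) ⟨⟨fun φ x hx => opT_mem_calM φ hx, fun x hx y hxy =>
      calM_anti f k.le_succ (calM_succ_of_relB hm hf hx hxy), ?_⟩,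
    fun x hx => opA_mem_calM hx, fun x hx z hxz => exists_relB_of_relNabla hk hx hxz⟩
  rintro φ - x hx y ⟨u, rfl, hu, hy⟩
  have huk (j : ℕ) : u j ∈ calM f k := by
    induction j with
    | zero => exact hx
    | succ j ih => exact calM_anti f k.le_succ (calM_succ_of_relB hm hf ih (hu j))
  -- Cutting the series at `K = k` suffices: the remainder lies in `bᵏ𝔼 ⊆ 𝓜ᵏ`.
  obtain ⟨w, hw⟩ := hy k
  rw [← sub_add_cancel y (∑ j ∈ Finset.range k, opT f (φ j) (u j))]
  exact add_mem (calM_of_relBPow hm hf k hw) (sum_mem fun j _ => opT_mem_calM _ (huk j))
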